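/- Let $n\ge 1$ and let $f:\mathbb{R}^n\to\mathbb{R}^n$ be a computable, injective, Lipschitz function. If $z\in\mathbb{R}^n$ is not computably random, then $f(z)$ is not computably random. (Equivalently: if $f(z)$ is computably random, then so is $z$.) Here $z\in\mathbb{R}^n$ is *computably random* if its binary expansion $Z\in\{0,1\}^{\mathbb{N}}$ is computably random, where $Z(nj+i)$, for $0\le i<n$ and $j\ge 0$, is the $j$-th bit after the binary point of the fractional part of the coordinate $z_i$ (coordinates are numbered from $0$ to $n-1$; dyadic rationals get the expansion ending in zeros). A sequence $Z$ is computably random if there is no computable martingale $d$ with $\sup_k d(Z{\upharpoonright}k)=\infty$; a martingale is a function $d$ from finite binary strings to $[0,\infty)$ with $d(\sigma 0)+d(\sigma 1)=2d(\sigma)$ for all $\sigma$, and it is computable if the reals $d(\sigma)$ are computable uniformly in $\sigma$. The function $f$ is *computable* if its values at dyadic points are uniformly computable and there is a computable $m:\mathbb{N}^2\to\mathbb{N}$ such that $|f(x)-f(y)|\le 2^{-k}$ whenever $|x|,|y|\le N$ and $|x-y|\le 2^{-m(N,k)}$. -/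

import Mathlib

/-- A family of real numbers indexed by a type of finite objects is *uniformly computable* if some
algorithm, given an index `x` and a precision `k`, returns the numerator of a dyadic rational with
denominator `2 ^ k` at distance at most `2 ^ (-k)` from `g x`. -/
def UniformlyComputable {α : Type} [Primcodable α] (g : α → ℝ) : Prop :=
  ∃ a : α → ℕ → ℤ, Computable₂ a ∧ ∀ x k, |g x - (a x k : ℝ) / 2 ^ k| ≤ (2 ^ k)⁻¹

/-- The dyadic point of `ℝᵐ` with coordinates `v i / 2 ^ s`. -/
noncomputable def dyadicPoint {m : ℕ} (v : Fin m → ℤ) (s : ℕ) : EuclideanSpace ℝ (Fin m) :=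
  WithLp.toLp 2 fun i => (v i : ℝ) / 2 ^ s

/-- Computable functions `ℝᵐ → ℝⁿ` in the sense of computable analysis (Grzegorczyk's form of the
definition): the values at dyadic points are uniformly computable, and there is a computable
modulus of uniform continuity on the closed balls of radius `N`, uniformly in `N`. -/
def IsComputableMap {m n : ℕ} (f : EuclideanSpace ℝ (Fin m) → EuclideanSpace ℝ (Fin n)) : Prop :=
  UniformlyComputable (fun p : ((Fin m → ℤ) × ℕ) × Fin n => f (dyadicPoint p.1.1 p.1.2) p.2) ∧
  ∃ μ : ℕ → ℕ → ℕ, Computable₂ μ ∧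
    ∀ (N k : ℕ) (x y : EuclideanSpace ℝ (Fin m)), ‖x‖ ≤ N → ‖y‖ ≤ N →
      ‖x - y‖ ≤ (2 ^ μ N k)⁻¹ → ‖f x - f y‖ ≤ (2 ^ k)⁻¹

/-- A (betting) martingale on finite binary strings, for the fair coin. -/
structure IsBettingMartingale (d : List Bool → ℝ) : Prop where
  nonneg : ∀ σ, 0 ≤ d σ
  fair : ∀ σ, d (σ ++ [false]) + d (σ ++ [true]) = 2 * d σ

/-- The initial segment of length `k` of an infinite binary sequence. -/
def initialSegment (Z : ℕ → Bool) (k : ℕ) : List Bool :=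
  (List.range k).map Z

/-- The martingale `d` succeeds on `Z`: its capital along `Z` is unbounded. -/
def SucceedsOn (d : List Bool → ℝ) (Z : ℕ → Bool) : Prop :=
  ∀ C : ℝ, ∃ k, C < d (initialSegment Z k)

/-- An infinite binary sequence is computably random if no computable martingale succeeds on it. -/
def IsComputablyRandomSeq (Z : ℕ → Bool) : Prop :=
  ∀ d : List Bool → ℝ, IsBettingMartingale d → UniformlyComputable d → ¬ SucceedsOn d Z

/-- The binary expansion of (the fractional part of) `z ∈ ℝⁿ`, `n ≥ 1`: the binary expansions of
the fractional parts of the coordinates, interleaved, so that the bit at position `n * j + i`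
is the `j`-th bit after the binary point of `z i`. -/
noncomputable def binaryExpansion {n : ℕ} [NeZero n] (z : EuclideanSpace ℝ (Fin n)) :
    ℕ → Bool :=
  fun k => decide (Real.digits (Int.fract (z (Fin.ofNat n k))) 2 (k / n) = 1)

/-- A point of `ℝⁿ`, `n ≥ 1`, is computably random if its binary expansion is. -/
def IsComputablyRandom {n : ℕ} [NeZero n] (z : EuclideanSpace ℝ (Fin n)) : Prop :=
  IsComputablyRandomSeq (binaryExpansion z)

/-! Let `Z` and `W` be the expansions of `z` and `f z`, and suppose that `W` is computably random. A
computable martingale succeeding on `Z` can be replaced, by putting savings aside, by a martingale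
`D` that tends to infinity along `Z` (`exists_tendsto_of_succeedsOn`). It is the density of a
measure on sequences; the plan is to transport this measure by `f` and to bet with the density of
the image.

The obstacle is that the digits of `f x` do not depend continuously on `x`. So the measure is
transported by a total computable map on sequences, which reads each output digit off a dyadic
approximation to `f` of fixed precision. Its digits may be wrong in general; they only have to be
right near `z`. By `floor_eq_of_not_constant`, an approximation to a real has the right digits
before `o` if it is precise to `o + c` digits and the true digits in `[o, o + c)` are neither all 0
nor all 1. Randomness of `W` supplies such blocks in two ways. `eventually_not_constant`: for all
large `j` the digits in `[j + 1, 3 j + 1)` are not constant in any coordinate, so that a precision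
fixed in advance suffices for digit `j`. `exists_not_constant`: there are arbitrarily late `o`
followed by a nonconstant block of the fixed length `c = n + 2`.

At such an `o`, the Lipschitz condition shows that every sequence agreeing with `Z` on `k = o + c +
κ` digits per coordinate is mapped to one agreeing with `W` on `o` digits per coordinate. By
`le_pushforwardMartingale` the image martingale has capital at least `D (Z ↾ n k) / 2 ^ (n (c + κ))`
there. The loss factor does not depend on `o`, so the image martingale succeeds on `W`, a
contradiction. -/

/-! ### Computability of elementary operations -/

theorem Primrec.nat_pow : Primrec₂ ((· ^ ·) : ℕ → ℕ → ℕ) :=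
  Primrec₂.unpaired'.1 Nat.Primrec.pow

theorem Primrec.nat_two_pow {α : Type*} [Primcodable α] {f : α → ℕ} (hf : Primrec f) :
    Primrec fun x => 2 ^ f x :=
  Primrec.nat_pow.comp (Primrec.const 2) hf

theorem Computable.nat_two_pow {α : Type*} [Primcodable α] {f : α → ℕ} (hf : Computable f) :
    Computable fun x => 2 ^ f x :=
  (Primrec.nat_two_pow Primrec.id).to_comp.comp hf

theorem Computable.nat_add' {α : Type*} [Primcodable α] {f g : α → ℕ} (hf : Computable f)
    (hg : Computable g) : Computable fun x => f x + g x :=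
  Primrec.nat_add.to_comp.comp hf hg

theorem Computable.nat_sub' {α : Type*} [Primcodable α] {f g : α → ℕ} (hf : Computable f)
    (hg : Computable g) : Computable fun x => f x - g x :=
  Primrec.nat_sub.to_comp.comp hf hg

theorem Computable.nat_mul' {α : Type*} [Primcodable α] {f g : α → ℕ} (hf : Computable f)
    (hg : Computable g) : Computable fun x => f x * g x :=
  Primrec.nat_mul.to_comp.comp hf hg

theorem Computable.nat_div' {α : Type*} [Primcodable α] {f g : α → ℕ} (hf : Computable f)
    (hg : Computable g) : Computable fun x => f x / g x :=
  Primrec.nat_div.to_comp.comp hf hg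

theorem Computable.nat_decide_lt {α : Type*} [Primcodable α] {f g : α → ℕ} (hf : Computable f)
    (hg : Computable g) : Computable fun x => decide (f x < g x) :=
  Primrec.nat_lt.decide.to_comp.comp hf hg

theorem Computable.decide_eq {α β : Type*} [Primcodable α] [Primcodable β] [DecidableEq β]
    {f g : α → β} (hf : Computable f) (hg : Computable g) :
    Computable fun x => decide (f x = g x) :=
  Primrec.eq.decide.to_comp.comp hf hg

theorem Computable.ite' {α σ : Type*} [Primcodable α] [Primcodable σ] {c : α → Prop}
    [DecidablePred c] {f g : α → σ} (hc : Computable fun x => decide (c x)) (hf : Computable f)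
    (hg : Computable g) : Computable fun x => if c x then f x else g x :=
  (Computable.cond hc hf hg).of_eq fun x => by by_cases h : c x <;> simp [h]

theorem Computable.list_take' {α β : Type*} [Primcodable α] [Primcodable β] {f : α → ℕ}
    {g : α → List β} (hf : Computable f) (hg : Computable g) :
    Computable fun x => (g x).take (f x) :=
  Primrec.list_take.to_comp.comp hf hg

theorem Computable.list_getD' {α β : Type*} [Primcodable α] [Primcodable β] {f : α → ℕ}
    {g : α → List β} (d : β) (hg : Computable g) (hf : Computable f) :
    Computable fun x => (g x).getD (f x) d :=
  (Primrec.list_getD d).to_comp.comp hg hf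

theorem Computable.sum_range {α : Type*} [Primcodable α] {N : α → ℕ} {F : α → ℕ → ℕ}
    (hN : Computable N) (hF : Computable₂ F) :
    Computable fun x => ∑ i ∈ Finset.range (N x), F x i := by
  have h : Computable₂ (fun (x : α) (p : ℕ × ℕ) => p.2 + F x p.1) :=
    Computable.nat_add' (Computable.snd.comp Computable.snd)
      (hF.comp Computable.fst (Computable.fst.comp Computable.snd))
  refine (Computable.nat_rec hN (Computable.const 0) h).of_eq fun x => ?_
  induction N x with
  | zero => rfl
  | succ m ih => rw [Finset.sum_range_succ, ← ih]

theorem Computable.decide_forall_lt {α : Type*} [Primcodable α] {N : α → ℕ} {P : α → ℕ → Prop}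
    [∀ x i, Decidable (P x i)] (hN : Computable N)
    (hP : Computable₂ fun x i => decide (P x i)) :
    Computable fun x => decide (∀ i < N x, P x i) := by
  have h : Computable fun x => decide (∑ i ∈ Finset.range (N x), (if P x i then 0 else 1) = 0) :=
    Computable.decide_eq (Computable.sum_range hN
      (Computable.ite' (c := fun p : α × ℕ => P p.1 p.2) hP (Computable.const 0)
        (Computable.const 1))) (Computable.const 0)
  exact h.of_eq fun x => by simp

/-- The encoding sends `ofNat m` to `2 * m` and `negSucc m` to `2 * m + 1`, so the parity of the
code tells the cases apart and halving recovers `m`. -/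
theorem Primrec.int_casesOn {α σ : Type*} [Primcodable α] [Primcodable σ] {f : α → ℤ}
    {g h : α → ℕ → σ} (hf : Primrec f) (hg : Primrec₂ g) (hh : Primrec₂ h) :
    Primrec fun x => (Int.casesOn (f x) (g x) (h x) : σ) := by
  have he : Primrec fun x => Encodable.encode (f x) := Primrec.encode.comp hf
  have hd : Primrec fun x => (Encodable.encode (f x)).div2 := Primrec.nat_div2.comp he
  refine (Primrec.cond (Primrec.nat_bodd.comp he) (hh.comp Primrec.id hd)
    (hg.comp Primrec.id hd)).of_eq fun x => ?_
  cases f x with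
  | ofNat m =>
    have : Encodable.encode (Int.ofNat m) = 2 * m := rfl
    rw [this]; simp [Nat.div2_val]
  | negSucc m =>
    have : Encodable.encode (Int.negSucc m) = 2 * m + 1 := rfl
    rw [this]; simp [Nat.div2_val]

theorem Primrec.int_ofNat : Primrec Int.ofNat := by
  refine Primrec.encode_iff.1 ?_
  exact (Primrec.nat_mul.comp (Primrec.const 2) Primrec.id).of_eq fun m => rfl

theorem Primrec.int_negSucc : Primrec Int.negSucc := by
  refine Primrec.encode_iff.1 ?_
  exact (Primrec.succ.comp (Primrec.nat_mul.comp (Primrec.const 2) Primrec.id)).of_eq fun m => rfl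

theorem Primrec.int_toNat : Primrec Int.toNat :=
  (Primrec.int_casesOn Primrec.id Primrec₂.right (Primrec₂.const 0)).of_eq fun x => by
    cases x <;> rfl

theorem Primrec.int_natCast_sub : Primrec₂ fun x y : ℕ => (x : ℤ) - y := by
  have : Primrec fun p : ℕ × ℕ =>
      if p.2 ≤ p.1 then Int.ofNat (p.1 - p.2) else Int.negSucc (p.2 - p.1 - 1) :=
    Primrec.ite (Primrec.nat_le.comp Primrec.snd Primrec.fst)
      (Primrec.int_ofNat.comp (Primrec.nat_sub.comp Primrec.fst Primrec.snd))
      (Primrec.int_negSucc.comp (Primrec.nat_sub.comp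
        (Primrec.nat_sub.comp Primrec.snd Primrec.fst) (Primrec.const 1)))
  refine this.of_eq fun p => ?_
  split_ifs with h
  · simp [h]
  · simp only [Int.negSucc_eq]; omega

/-- The parity of the integer part of `a / 2 ^ s` is computable from `a` and `s`. -/
theorem Primrec.int_bit : Primrec₂ fun (a : ℤ) (s : ℕ) => decide (a / 2 ^ s % 2 = 1) := by
  have hb : Primrec₂ fun (p : ℤ × ℕ) (m : ℕ) => decide (m / 2 ^ p.2 % 2 = 1) :=
    Primrec.eq.decide.comp (Primrec.nat_mod.comp (Primrec.nat_div.comp Primrec.snd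
      (Primrec.nat_two_pow (Primrec.snd.comp Primrec.fst))) (Primrec.const 2)) (Primrec.const 1)
  have hn : Primrec₂ fun (p : ℤ × ℕ) (m : ℕ) => !decide (m / 2 ^ p.2 % 2 = 1) :=
    Primrec.not.comp hb
  refine (Primrec.int_casesOn (Primrec.fst (α := ℤ) (β := ℕ)) hb hn).of_eq
    fun p => ?_
  obtain ⟨a, s⟩ := p
  cases a with
  | ofNat m =>
    have : (Int.ofNat m) / 2 ^ s % 2 = ((m / 2 ^ s % 2 : ℕ) : ℤ) := by push_cast; rfl
    simp only [this]
    norm_cast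
  | negSucc m =>
    -- The quotient is `-(q + 1)` with `q = m / 2 ^ s`, whose parity is opposite to that of `q`;
    -- hence the negated digit in `hn`.
    have : (Int.negSucc m) / 2 ^ s = -((m / 2 ^ s : ℕ) : ℤ) - 1 := by
      rw [Int.negSucc_ediv _ (by positivity)]; push_cast
      change -((m : ℤ) / 2 ^ s + 1) = _
      ring
    simp only [this, Bool.not_eq_eq_eq_not]
    rw [← decide_not, decide_eq_decide]
    omega

/-! ### Arithmetic of computable nonnegative reals -/

/-- A family of nonnegative reals with uniformly computable natural dyadic approximations. -/
def HasNatApprox {α : Type} [Primcodable α] (g : α → ℝ) : Prop :=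
  ∃ A : α → ℕ → ℕ, Computable₂ A ∧ ∀ x k, |g x - (A x k : ℝ) / 2 ^ k| ≤ (2 ^ k)⁻¹

namespace HasNatApprox

variable {α β : Type} [Primcodable α] [Primcodable β]

theorem uniformlyComputable {g : α → ℝ} (h : HasNatApprox g) : UniformlyComputable g := by
  obtain ⟨A, hA, h⟩ := h
  exact ⟨fun x k => Int.ofNat (A x k), Primrec.int_ofNat.to_comp.comp hA, fun x k => by
    simpa using h x k⟩

theorem of_uniformlyComputable {g : α → ℝ} (h : UniformlyComputable g) (hg : ∀ x, 0 ≤ g x) :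
    HasNatApprox g := by
  obtain ⟨A, hA, h⟩ := h
  refine ⟨fun x k => (A x k).toNat, Primrec.int_toNat.to_comp.comp hA, fun x k => ?_⟩
  rcases le_total 0 (A x k) with h0 | h0
  · have : (((A x k).toNat : ℕ) : ℝ) = (A x k : ℝ) := by
      exact_mod_cast congrArg (Int.cast : ℤ → ℝ) (Int.toNat_of_nonneg h0)
    rw [this]; exact h x k
  · have h1 : (A x k : ℝ) / 2 ^ k ≤ 0 :=
      div_nonpos_of_nonpos_of_nonneg (by exact_mod_cast h0) (by positivity)
    have h2 := (abs_le.1 (h x k)).2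
    simp only [Int.toNat_of_nonpos h0]
    rw [abs_of_nonneg (by simpa using hg x)]
    simp only [Nat.cast_zero, zero_div, sub_zero]
    linarith

theorem comp {g : β → ℝ} (h : HasNatApprox g) {f : α → β} (hf : Computable f) :
    HasNatApprox fun x => g (f x) := by
  obtain ⟨A, hA, h⟩ := h
  exact ⟨fun x k => A (f x) k, hA.comp (hf.comp Computable.fst) Computable.snd,
    fun x k => h (f x) k⟩

/-- Rounding to the nearest multiple of `2 ^ (-k)` costs at most `2 ^ (-(k + 1))`, so any
approximation with half the allowed error may have an arbitrary computable dyadic denominator. -/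
theorem of_approx {g : α → ℝ} {A e : α → ℕ → ℕ} (hA : Computable₂ A) (he : Computable₂ e)
    (h : ∀ x k, |g x - (A x k : ℝ) / 2 ^ e x k| ≤ (2 ^ (k + 1))⁻¹) : HasNatApprox g := by
  refine ⟨fun x k => (A x k * 2 ^ (k + 1) + 2 ^ e x k) / 2 ^ (e x k + 1), ?_, fun x k => ?_⟩
  · exact Computable.nat_div' (Computable.nat_add' (Computable.nat_mul' hA
      (Computable.nat_two_pow (Computable.succ.comp Computable.snd)))
      (Computable.nat_two_pow he)) (Computable.nat_two_pow (Computable.succ.comp he))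
  · have h1 := abs_le.1 (h x k)
    set a := A x k
    set m := e x k
    set q := (a * 2 ^ (k + 1) + 2 ^ m) / 2 ^ (m + 1) with hq
    have hm : (0 : ℝ) < 2 ^ m := by positivity
    have hk : (0 : ℝ) < 2 ^ k := by positivity
    have l1 : (q : ℝ) * 2 ^ (m + 1) ≤ a * 2 ^ (k + 1) + 2 ^ m := by
      exact_mod_cast Nat.div_mul_le_self _ _
    have l2 : (a : ℝ) * 2 ^ (k + 1) + 2 ^ m < (q + 1) * 2 ^ (m + 1) := by
      have := Nat.lt_div_mul_add (a := a * 2 ^ (k + 1) + 2 ^ m) (b := 2 ^ (m + 1)) (by positivity)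
      rw [← hq] at this
      have h3 : ((a * 2 ^ (k + 1) + 2 ^ m : ℕ) : ℝ) < ((q * 2 ^ (m + 1) + 2 ^ (m + 1) : ℕ) : ℝ) := by
        exact_mod_cast this
      push_cast at h3; linarith
    have e1 : |(a : ℝ) / 2 ^ m - q / 2 ^ k| ≤ (2 ^ (k + 1))⁻¹ := by
      have : (a : ℝ) / 2 ^ m - q / 2 ^ k
          = (a * 2 ^ (k + 1) - q * 2 ^ (m + 1)) / (2 ^ m * 2 ^ (k + 1)) := by
        field_simp
        ring
      rw [this, abs_div, abs_of_pos (by positivity : (0 : ℝ) < 2 ^ m * 2 ^ (k + 1)),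
        div_le_iff₀ (by positivity)]
      have : (2 ^ (k + 1) : ℝ)⁻¹ * (2 ^ m * 2 ^ (k + 1)) = 2 ^ m := by field_simp
      rw [this, abs_le, pow_succ 2 m]
      rw [pow_succ 2 m] at l1 l2
      constructor <;> linarith
    have e2 : ((2 : ℝ) ^ k)⁻¹ = (2 ^ (k + 1))⁻¹ + (2 ^ (k + 1))⁻¹ := by
      rw [pow_succ]; field_simp; norm_num
    have e1 := abs_le.1 e1
    rw [abs_le, e2]
    constructor <;> linarith

theorem add {f g : α → ℝ} (hf : HasNatApprox f) (hg : HasNatApprox g) :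
    HasNatApprox fun x => f x + g x := by
  obtain ⟨A, hA, h⟩ := hf
  obtain ⟨B, hB, h'⟩ := hg
  have hk : Computable₂ fun (_ : α) (k : ℕ) => k + 2 :=
    Computable.succ.comp (Computable.succ.comp Computable.snd)
  refine of_approx (A := fun x k => A x (k + 2) + B x (k + 2)) (e := fun _ k => k + 2)
    (Computable.nat_add' (hA.comp Computable.fst hk) (hB.comp Computable.fst hk)) hk fun x k => ?_
  have h1 := abs_le.1 (h x (k + 2))
  have h2 := abs_le.1 (h' x (k + 2))
  have e2 : ((2 : ℝ) ^ (k + 1))⁻¹ = (2 ^ (k + 2))⁻¹ + (2 ^ (k + 2))⁻¹ := by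
    rw [pow_succ _ (k + 1)]; field_simp; norm_num
  push_cast
  rw [add_div, e2, abs_le]
  constructor <;> linarith

/-- The factor is at most `2 ^ u x`, so `u x` extra bits of precision absorb it. -/
theorem mul_dyadic {g : α → ℝ} (hg : HasNatApprox g) {u v : α → ℕ} (hu : Computable u)
    (hv : Computable v) : HasNatApprox fun x => g x * (u x / 2 ^ v x) := by
  obtain ⟨A, hA, h⟩ := hg
  have hk : Computable₂ fun (x : α) (k : ℕ) => k + 1 + u x :=
    Computable.nat_add' (Computable.succ.comp Computable.snd) (hu.comp Computable.fst)
  refine of_approx (A := fun x k => A x (k + 1 + u x) * u x) (e := fun x k => k + 1 + u x + v x)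
    (Computable.nat_mul' (hA.comp Computable.fst hk) (hu.comp Computable.fst))
    (Computable.nat_add' hk (hv.comp Computable.fst)) fun x k => ?_
  have h1 := h x (k + 1 + u x)
  have e : g x * (u x / 2 ^ v x) - ((A x (k + 1 + u x) * u x : ℕ) : ℝ) / 2 ^ (k + 1 + u x + v x)
      = (g x - A x (k + 1 + u x) / 2 ^ (k + 1 + u x)) * (u x / 2 ^ v x) := by
    push_cast; rw [pow_add _ _ (v x)]; field_simp
  rw [e, abs_mul, abs_of_nonneg (by positivity : (0 : ℝ) ≤ u x / 2 ^ v x)]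
  have h2 : (u x : ℝ) / 2 ^ v x ≤ 2 ^ u x := by
    rw [div_le_iff₀ (by positivity)]
    have h3 : (u x : ℝ) ≤ 2 ^ u x := by exact_mod_cast Nat.lt_two_pow_self.le
    have h4 : (1 : ℝ) ≤ 2 ^ v x := one_le_pow₀ (by norm_num)
    nlinarith [h3, h4, (by positivity : (0 : ℝ) < 2 ^ u x)]
  calc _ ≤ (2 ^ (k + 1 + u x) : ℝ)⁻¹ * 2 ^ u x := by gcongr
    _ = (2 ^ (k + 1))⁻¹ := by rw [pow_add _ _ (u x)]; field_simp

theorem natCast {u : α → ℕ} (hu : Computable u) : HasNatApprox fun x => (u x : ℝ) := by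
  refine ⟨fun x k => u x * 2 ^ k, Computable.nat_mul' (hu.comp Computable.fst)
    (Computable.nat_two_pow Computable.snd), fun x k => ?_⟩
  push_cast
  rw [mul_div_assoc, div_self (by positivity), mul_one, sub_self, abs_zero]
  positivity

theorem sum_range {g : α → ℕ → ℝ} (hg : HasNatApprox fun p : α × ℕ => g p.1 p.2) {N : α → ℕ}
    (hN : Computable N) : HasNatApprox fun x => ∑ i ∈ Finset.range (N x), g x i := by
  obtain ⟨A, hA, h⟩ := hg
  have hk : Computable₂ fun (x : α) (k : ℕ) => k + 1 + N x :=
    Computable.nat_add' (Computable.succ.comp Computable.snd) (hN.comp Computable.fst)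
  refine of_approx (A := fun x k => ∑ i ∈ Finset.range (N x), A (x, i) (k + 1 + N x))
    (e := fun x k => k + 1 + N x)
    (Computable.sum_range (hN.comp Computable.fst) (hA.comp
      (Computable.pair (Computable.fst.comp Computable.fst) Computable.snd)
      (hk.comp (Computable.fst.comp Computable.fst) (Computable.snd.comp Computable.fst))))
    hk fun x k => ?_
  push_cast
  rw [Finset.sum_div, ← Finset.sum_sub_distrib]
  calc _ ≤ ∑ i ∈ Finset.range (N x), |g x i - A (x, i) (k + 1 + N x) / 2 ^ (k + 1 + N x)| :=
        Finset.abs_sum_le_sum_abs _ _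
    _ ≤ ∑ i ∈ Finset.range (N x), (2 ^ (k + 1 + N x) : ℝ)⁻¹ :=
        Finset.sum_le_sum fun i _ => h (x, i) _
    _ = N x * (2 ^ (k + 1 + N x) : ℝ)⁻¹ := by simp
    _ ≤ 2 ^ N x * (2 ^ (k + 1 + N x) : ℝ)⁻¹ := by
        gcongr; exact_mod_cast Nat.lt_two_pow_self.le
    _ = (2 ^ (k + 1))⁻¹ := by rw [pow_add _ _ (N x)]; field_simp

theorem tsum {g : α → ℕ → ℝ} (hg : HasNatApprox fun p : α × ℕ => g p.1 p.2) {c : α → ℕ}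
    (hc : Computable c) (h0 : ∀ x i, 0 ≤ g x i) (hle : ∀ x i, g x i ≤ 2 ^ c x * (1 / 2) ^ i) :
    HasNatApprox fun x => ∑' i, g x i := by
  have hN : Computable fun p : α × ℕ => c p.1 + p.2 + 3 :=
    Computable.nat_add' (Computable.nat_add' (hc.comp Computable.fst) Computable.snd)
      (Computable.const 3)
  obtain ⟨A, hA, h⟩ := sum_range (α := α × ℕ) (g := fun p i => g p.1 i)
    (hg.comp (Computable.pair (Computable.fst.comp Computable.fst) Computable.snd)) hN
  have hk : Computable₂ fun (_ : α) (k : ℕ) => k + 2 :=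
    Computable.succ.comp (Computable.succ.comp Computable.snd)
  refine of_approx (A := fun x k => A (x, k) (k + 2)) (e := fun _ k => k + 2)
    (hA.comp Computable.id hk) hk fun x k => ?_
  have hs : Summable (g x) := Summable.of_nonneg_of_le (h0 x) (hle x)
    (summable_geometric_two.mul_left _)
  -- The tail after `M` terms is at most `2 ^ c x * 2 ^ (-M) * 2 = 2 ^ (-(k + 2))`.
  set M := c x + k + 3 with hM
  have h1 : |∑ i ∈ Finset.range M, g x i - A (x, k) (k + 2) / 2 ^ (k + 2)| ≤ (2 ^ (k + 2))⁻¹ :=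
    h (x, k) (k + 2)
  have h2 := hs.sum_add_tsum_nat_add M
  have h3 : 0 ≤ ∑' i, g x (i + M) := tsum_nonneg fun i => h0 x _
  have h4 : ∑' i, g x (i + M) ≤ (2 ^ (k + 2))⁻¹ := by
    calc _ ≤ ∑' i, 2 ^ c x * (1 / 2 : ℝ) ^ M * (1 / 2) ^ i := by
          refine ((summable_nat_add_iff M).2 hs).tsum_le_tsum (fun i => ?_)
            (summable_geometric_two.mul_left _)
          refine (hle x _).trans_eq ?_
          rw [pow_add]; ring
      _ = 2 ^ c x * (1 / 2 : ℝ) ^ M * 2 := by rw [tsum_mul_left, tsum_geometric_two]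
      _ = (2 ^ (k + 2))⁻¹ := by
          rw [hM, one_div, inv_pow, pow_add, pow_add]; field_simp; ring
  have e2 : ((2 : ℝ) ^ (k + 1))⁻¹ = (2 ^ (k + 2))⁻¹ + (2 ^ (k + 2))⁻¹ := by
    rw [pow_succ _ (k + 1)]; field_simp; norm_num
  have h1 := abs_le.1 h1
  rw [abs_le, e2]
  constructor <;> linarith

end HasNatApprox

/-! ### The savings trick: from unbounded capital to capital tending to infinity -/

theorem length_initialSegment (Z : ℕ → Bool) (k : ℕ) : (initialSegment Z k).length = k := by
  simp [initialSegment]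

theorem initialSegment_succ (Z : ℕ → Bool) (k : ℕ) :
    initialSegment Z (k + 1) = initialSegment Z k ++ [Z k] := by
  simp [initialSegment, List.range_succ]

theorem take_initialSegment (Z : ℕ → Bool) {p k : ℕ} (h : p ≤ k) :
    (initialSegment Z k).take p = initialSegment Z p := by
  simp [initialSegment, ← List.map_take, List.take_range, h]

theorem getD_initialSegment (Z : ℕ → Bool) {p k : ℕ} (h : p < k) :
    (initialSegment Z k).getD p false = Z p := by
  simp [initialSegment, h]

/-- The number of times that the strategy of `savings` has put money aside after the first `p`
bits of `σ`, where `A` gives approximations to the capital. -/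
def saveCount (A : List Bool → ℕ) (σ : List Bool) : ℕ → ℕ
  | 0 => 0
  | p + 1 =>
    if 2 ^ saveCount A σ p < A (σ.take (p + 1)) then saveCount A σ p + 1 else saveCount A σ p

theorem saveCount_append (A : List Bool → ℕ) (σ τ : List Bool) :
    ∀ p, p ≤ σ.length → saveCount A (σ ++ τ) p = saveCount A σ p
  | 0, _ => rfl
  | p + 1, h => by
    simp only [saveCount, saveCount_append A σ τ p (by omega), List.take_append_of_le_length h]

theorem computable_saveCount {A : List Bool → ℕ} (hA : Computable A) :
    Computable fun p : List Bool × ℕ => saveCount A p.1 p.2 := by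
  have hstep : Computable₂ fun (p : List Bool × ℕ) (q : ℕ × ℕ) =>
      if 2 ^ q.2 < A (p.1.take (q.1 + 1)) then q.2 + 1 else q.2 := by
    have h2 : Computable fun x : (List Bool × ℕ) × (ℕ × ℕ) => x.2.2 :=
      Computable.snd.comp Computable.snd
    exact Computable.ite' (Computable.nat_decide_lt (Computable.nat_two_pow h2)
      (hA.comp (Computable.list_take' (Computable.succ.comp (Computable.fst.comp Computable.snd))
        (Computable.fst.comp Computable.fst)))) (Computable.succ.comp h2) h2
  refine (Computable.nat_rec Computable.snd (Computable.const 0) hstep).of_eq fun p => ?_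
  obtain ⟨σ, k⟩ := p
  induction k with
  | zero => rfl
  | succ k ih => simp only at ih ⊢; rw [ih]; rfl

/-- The money put aside along `σ`. -/
noncomputable def savings (A : List Bool → ℕ) (d : List Bool → ℝ) (σ : List Bool) : ℝ :=
  ∑ p ∈ Finset.range σ.length, d (σ.take (p + 1)) *
    (((saveCount A σ (p + 1) - saveCount A σ p : ℕ) : ℝ) / 2 ^ saveCount A σ (p + 1))

/-- The martingale that bets like `d` but puts half of its working capital aside whenever this
capital has become large. -/
noncomputable def savingMartingale (A : List Bool → ℕ) (d : List Bool → ℝ) (σ : List Bool) : ℝ :=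
  d σ * (((1 : ℕ) : ℝ) / 2 ^ saveCount A σ σ.length) + savings A d σ

theorem savings_append_singleton (A : List Bool → ℕ) (d : List Bool → ℝ) (σ : List Bool)
    (b : Bool) :
    savings A d (σ ++ [b]) = savings A d σ + d (σ ++ [b]) *
      (((saveCount A (σ ++ [b]) (σ ++ [b]).length - saveCount A σ σ.length : ℕ) : ℝ) /
        2 ^ saveCount A (σ ++ [b]) (σ ++ [b]).length) := by
  have hl : (σ ++ [b]).length = σ.length + 1 := by simp
  unfold savings
  rw [hl, Finset.sum_range_succ, saveCount_append A σ [b] σ.length le_rfl]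
  congr 1
  · refine Finset.sum_congr rfl fun p hp => ?_
    have hp := Finset.mem_range.1 hp
    rw [saveCount_append A σ [b] (p + 1) hp, saveCount_append A σ [b] p hp.le,
      List.take_append_of_le_length (by omega)]
  · rw [List.take_of_length_le (by simp)]

theorem saveCount_append_singleton (A : List Bool → ℕ) (σ : List Bool) (b : Bool) :
    saveCount A (σ ++ [b]) (σ ++ [b]).length =
      if 2 ^ saveCount A σ σ.length < A (σ ++ [b]) then saveCount A σ σ.length + 1
      else saveCount A σ σ.length := by
  have hl : (σ ++ [b]).length = σ.length + 1 := by simp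
  rw [hl, saveCount, saveCount_append A σ [b] _ le_rfl, List.take_of_length_le (by simp)]

/-- Moving money from the working capital to the savings does not change the total, so whether a
transfer takes place at the last bit is irrelevant. Fairness follows at once. -/
theorem savingMartingale_append_singleton (A : List Bool → ℕ) (d : List Bool → ℝ) (σ : List Bool)
    (b : Bool) :
    savingMartingale A d (σ ++ [b]) =
      savings A d σ + d (σ ++ [b]) / 2 ^ saveCount A σ σ.length := by
  rw [savingMartingale, savings_append_singleton, saveCount_append_singleton]
  split_ifs
  · rw [Nat.add_sub_cancel_left, pow_succ]; field_simp; push_cast; ring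
  · simp; ring

theorem savings_nonneg {A : List Bool → ℕ} {d : List Bool → ℝ} (hd : ∀ σ, 0 ≤ d σ)
    (σ : List Bool) : 0 ≤ savings A d σ :=
  Finset.sum_nonneg fun _ _ => mul_nonneg (hd _) (by positivity)

theorem IsBettingMartingale.savingMartingale {d : List Bool → ℝ} (hd : IsBettingMartingale d)
    (A : List Bool → ℕ) : IsBettingMartingale (savingMartingale A d) where
  nonneg σ := add_nonneg (mul_nonneg (hd.nonneg σ) (by positivity)) (savings_nonneg hd.nonneg σ)
  fair σ := by
    rw [savingMartingale_append_singleton, savingMartingale_append_singleton, _root_.savingMartingale]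
    have := hd.fair σ
    field_simp
    push_cast
    linear_combination this

/-- Every transfer is worth at least `1 / 2`: it happens when the working capital before halving, `d
/ 2 ^ saveCount`, is at least 1. -/
theorem saveCount_le_savings {A : List Bool → ℕ} {d : List Bool → ℝ}
    (hA : ∀ σ, |d σ - A σ| ≤ 1) (σ : List Bool) :
    (saveCount A σ σ.length : ℝ) / 2 ≤ savings A d σ := by
  induction σ using List.reverseRecOn with
  | nil => simp [saveCount, savings]
  | append_singleton σ b ih =>
    rw [savings_append_singleton, saveCount_append_singleton]
    split_ifs with h
    · rw [Nat.add_sub_cancel_left]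
      -- The strict inequality of naturals leaves a margin of 1, which absorbs the error of `A`.
      have h1 : ((2 ^ saveCount A σ σ.length + 1 : ℕ) : ℝ) ≤ A (σ ++ [b]) := by exact_mod_cast h
      have h2 := (abs_le.1 (hA (σ ++ [b]))).1
      push_cast at h1
      have h3 : (1 : ℝ) / 2 ≤
          d (σ ++ [b]) * (((1 : ℕ) : ℝ) / 2 ^ (saveCount A σ σ.length + 1)) := by
        rw [mul_div_assoc', div_le_div_iff₀ (by norm_num) (by positivity), pow_succ]
        push_cast
        linarith
      push_cast at h3 ⊢
      linarith
    · simpa using ih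

theorem tendsto_saveCount {A : List Bool → ℕ} {d : List Bool → ℝ} (hd : ∀ σ, 0 ≤ d σ)
    (hA : ∀ σ, |d σ - A σ| ≤ 1) {Z : ℕ → Bool} (hZ : SucceedsOn d Z) :
    Filter.Tendsto (fun k => saveCount A (initialSegment Z k) k) Filter.atTop Filter.atTop := by
  have hstep : ∀ k, saveCount A (initialSegment Z (k + 1)) (k + 1) =
      if 2 ^ saveCount A (initialSegment Z k) k < A (initialSegment Z (k + 1)) then
        saveCount A (initialSegment Z k) k + 1 else saveCount A (initialSegment Z k) k := by
    intro k
    have h := saveCount_append_singleton A (initialSegment Z k) (Z k)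
    rwa [← initialSegment_succ, length_initialSegment, length_initialSegment] at h
  have hmono : Monotone fun k => saveCount A (initialSegment Z k) k := by
    refine monotone_nat_of_le_succ fun k => ?_
    rw [hstep]
    split_ifs <;> omega
  refine Filter.tendsto_atTop_atTop_of_monotone hmono fun b => ?_
  induction b with
  | zero => exact ⟨0, Nat.zero_le _⟩
  | succ b ih =>
    obtain ⟨k, hk⟩ := ih
    by_contra! hcon
    -- The sum forces `j > k`; if the count stayed at `b` from `k` on, then `A ≤ 2 ^ b` and `d ≤ 2 ^
    -- b + 1` there.
    obtain ⟨j, hj⟩ := hZ (2 ^ b + 1 + ∑ i ∈ Finset.range (k + 1), d (initialSegment Z i))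
    have hpos : 0 ≤ ∑ i ∈ Finset.range (k + 1), d (initialSegment Z i) :=
      Finset.sum_nonneg fun _ _ => hd _
    rcases Nat.lt_or_ge k j with hkj | hkj
    · obtain ⟨l, rfl⟩ : ∃ l, j = l + 1 := ⟨j - 1, by omega⟩
      have e : ∀ m, k ≤ m → saveCount A (initialSegment Z m) m = b := fun m hm => by
        have h1 := hcon m
        have h2 := hk.trans (hmono hm)
        simp only at h2
        omega
      have h3 := hstep l
      rw [e l (by omega), e (l + 1) (by omega)] at h3
      split_ifs at h3 with h4
      · omega
      · have h5 : (A (initialSegment Z (l + 1)) : ℝ) ≤ 2 ^ b := by exact_mod_cast not_lt.1 h4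
        have h6 := (abs_le.1 (hA (initialSegment Z (l + 1)))).2
        linarith
    · have : d (initialSegment Z j) ≤ ∑ i ∈ Finset.range (k + 1), d (initialSegment Z i) :=
        Finset.single_le_sum (f := fun i => d (initialSegment Z i)) (fun _ _ => hd _)
          (Finset.mem_range.2 (by omega))
      have : (0 : ℝ) < 2 ^ b := by positivity
      linarith

/-- A computable martingale that succeeds on `Z` can be replaced by one whose capital tends to
infinity along `Z`. -/
theorem exists_tendsto_of_succeedsOn {d : List Bool → ℝ} (hd : IsBettingMartingale d)
    (hc : UniformlyComputable d) {Z : ℕ → Bool} (hZ : SucceedsOn d Z) :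
    ∃ D, IsBettingMartingale D ∧ HasNatApprox D ∧
      Filter.Tendsto (fun k => D (initialSegment Z k)) Filter.atTop Filter.atTop := by
  have hn := HasNatApprox.of_uniformlyComputable hc hd.nonneg
  obtain ⟨A', hA', hA⟩ := id hn
  set A : List Bool → ℕ := fun σ => A' σ 0
  have hcA : Computable A := hA'.comp Computable.id (Computable.const 0)
  have hA1 : ∀ σ, |d σ - A σ| ≤ 1 := fun σ => by simpa using hA σ 0
  have hcount := computable_saveCount hcA
  refine ⟨savingMartingale A d, hd.savingMartingale A, ?_, ?_⟩
  · refine HasNatApprox.add (hn.mul_dyadic (Computable.const 1)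
      (hcount.comp (Computable.pair Computable.id Computable.list_length))) ?_
    have h1 : Computable fun x : List Bool × ℕ => saveCount A x.1 (x.2 + 1) :=
      hcount.comp (Computable.pair Computable.fst (Computable.succ.comp Computable.snd))
    refine HasNatApprox.sum_range (HasNatApprox.mul_dyadic (hn.comp
      (Computable.list_take' (Computable.succ.comp Computable.snd) Computable.fst))
      (Computable.nat_sub' h1 hcount) h1) Computable.list_length
  · have h := (tendsto_natCast_atTop_atTop (R := ℝ)).comp (tendsto_saveCount hd.nonneg hA1 hZ)
    refine Filter.tendsto_atTop_mono (fun k => ?_) (h.atTop_div_const (by norm_num : (0 : ℝ) < 2))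
    have h1 := saveCount_le_savings hA1 (initialSegment Z k)
    rw [length_initialSegment] at h1
    refine h1.trans ?_
    rw [savingMartingale]
    have := hd.nonneg (initialSegment Z k)
    have : 0 ≤ d (initialSegment Z k) * (((1 : ℕ) : ℝ) /
      2 ^ saveCount A (initialSegment Z k) (initialSegment Z k).length) := by positivity
    linarith

/-! ### Sums over binary strings -/

/-- The sum of `h` over all binary strings of length `L`. -/
def sumStrings : ℕ → (List Bool → ℝ) → ℝ
  | 0, h => h []
  | L + 1, h => sumStrings L (fun ρ => h (false :: ρ)) + sumStrings L (fun ρ => h (true :: ρ))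

theorem sumStrings_congr : ∀ {L : ℕ} {h h' : List Bool → ℝ},
    (∀ σ, σ.length = L → h σ = h' σ) → sumStrings L h = sumStrings L h'
  | 0, _, _, H => H [] rfl
  | L + 1, _, _, H => by
    simp only [sumStrings]
    rw [sumStrings_congr fun σ hσ => H (false :: σ) (by simp [hσ]),
      sumStrings_congr fun σ hσ => H (true :: σ) (by simp [hσ])]

theorem sumStrings_mono : ∀ {L : ℕ} {h h' : List Bool → ℝ},
    (∀ σ, σ.length = L → h σ ≤ h' σ) → sumStrings L h ≤ sumStrings L h'
  | 0, _, _, H => H [] rfl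
  | L + 1, _, _, H => add_le_add
    (sumStrings_mono fun σ hσ => H (false :: σ) (by simp [hσ]))
    (sumStrings_mono fun σ hσ => H (true :: σ) (by simp [hσ]))

theorem sumStrings_const (c : ℝ) : ∀ L, sumStrings L (fun _ => c) = 2 ^ L * c
  | 0 => by simp [sumStrings]
  | L + 1 => by simp only [sumStrings, sumStrings_const c L]; ring

theorem sumStrings_nonneg {L : ℕ} {h : List Bool → ℝ} (H : ∀ σ, 0 ≤ h σ) :
    0 ≤ sumStrings L h := by
  have := sumStrings_mono (L := L) (h := fun _ => 0) (h' := h) fun σ _ => H σ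
  rwa [sumStrings_const, mul_zero] at this

theorem sumStrings_add (h h' : List Bool → ℝ) : ∀ L,
    sumStrings L (fun ρ => h ρ + h' ρ) = sumStrings L h + sumStrings L h'
  | 0 => rfl
  | L + 1 => by
    simp only [sumStrings]
    rw [sumStrings_add (fun ρ => h (false :: ρ)), sumStrings_add (fun ρ => h (true :: ρ))]
    ring

theorem sumStrings_mul_left (c : ℝ) : ∀ (L : ℕ) (h : List Bool → ℝ),
    sumStrings L (fun ρ => c * h ρ) = c * sumStrings L h
  | 0, _ => rfl
  | L + 1, h => by
    simp only [sumStrings]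
    rw [sumStrings_mul_left c L (fun ρ => h (false :: ρ)),
      sumStrings_mul_left c L (fun ρ => h (true :: ρ))]
    ring

theorem sumStrings_sum {ι : Type*} (s : Finset ι) (L : ℕ) (h : ι → List Bool → ℝ) :
    sumStrings L (fun ρ => ∑ i ∈ s, h i ρ) = ∑ i ∈ s, sumStrings L (h i) := by
  classical
  induction s using Finset.induction_on with
  | empty => simpa using sumStrings_const 0 L
  | insert a s ha ih =>
    simp only [Finset.sum_insert ha]
    rw [sumStrings_add, ih]

theorem sumStrings_append (b : ℕ) : ∀ (a : ℕ) (h : List Bool → ℝ),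
    sumStrings (a + b) h = sumStrings a fun ρ => sumStrings b fun ρ' => h (ρ ++ ρ')
  | 0, h => by simp [sumStrings]
  | a + 1, h => by
    rw [Nat.add_right_comm]
    simp only [sumStrings]
    rw [sumStrings_append b a, sumStrings_append b a]
    rfl

theorem le_sumStrings {h : List Bool → ℝ} (H : ∀ σ, 0 ≤ h σ) (σ : List Bool) :
    h σ ≤ sumStrings σ.length h := by
  induction σ generalizing h with
  | nil => exact le_rfl
  | cons b σ ih =>
    have h0 : 0 ≤ sumStrings σ.length fun ρ => h (false :: ρ) := sumStrings_nonneg fun _ => H _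
    have h1 : 0 ≤ sumStrings σ.length fun ρ => h (true :: ρ) := sumStrings_nonneg fun _ => H _
    have h2 := ih (h := fun ρ => h (b :: ρ)) fun _ => H _
    simp only [List.length_cons, sumStrings]
    cases b <;> linarith

theorem IsBettingMartingale.sumStrings_eq {d : List Bool → ℝ} (hd : IsBettingMartingale d) :
    ∀ (L : ℕ) (σ : List Bool), sumStrings L (fun ρ => d (σ ++ ρ)) = 2 ^ L * d σ
  | 0, σ => by simp [sumStrings]
  | L + 1, σ => by
    have h := fun b => hd.sumStrings_eq L (σ ++ [b])
    simp only [List.append_assoc, List.singleton_append] at h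
    simp only [sumStrings, h]
    rw [← mul_add, hd.fair σ]
    ring

/-- The binary digits of `i`, the least significant one first, as a string of length `L`. -/
def digitString (L i : ℕ) : List Bool := (List.range L).map fun q => decide (i / 2 ^ q % 2 = 1)

theorem digitString_succ (L i : ℕ) :
    digitString (L + 1) i = decide (i % 2 = 1) :: digitString L (i / 2) := by
  simp [digitString, List.range_succ_eq_map, Nat.div_div_eq_div_mul, pow_succ']

theorem sum_range_two_mul (f : ℕ → ℝ) (N : ℕ) :
    ∑ i ∈ Finset.range (2 * N), f i =
      ∑ i ∈ Finset.range N, f (2 * i) + ∑ i ∈ Finset.range N, f (2 * i + 1) := by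
  induction N with
  | zero => simp
  | succ N ih =>
    rw [Nat.mul_succ, Finset.sum_range_succ, Finset.sum_range_succ, ih, Finset.sum_range_succ,
      Finset.sum_range_succ]
    ring

/-- Enumerating the strings by numbers reduces the computability of such sums to
`HasNatApprox.sum_range`. -/
theorem sumStrings_eq_sum_range : ∀ (L : ℕ) (h : List Bool → ℝ),
    sumStrings L h = ∑ i ∈ Finset.range (2 ^ L), h (digitString L i)
  | 0, h => by simp [sumStrings, digitString]
  | L + 1, h => by
    rw [pow_succ', sum_range_two_mul, sumStrings, sumStrings_eq_sum_range L,
      sumStrings_eq_sum_range L]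
    congr 1 <;> refine Finset.sum_congr rfl fun i _ => ?_
    · rw [digitString_succ]; simp
    · rw [digitString_succ]; simp [Nat.add_mod, Nat.add_div]

theorem primrec_digitString : Primrec₂ digitString := by
  refine Primrec.list_map (Primrec.list_range.comp Primrec.fst) ?_
  exact Primrec.eq.decide.comp (Primrec.nat_mod.comp (Primrec.nat_div.comp
    (Primrec.snd.comp Primrec.fst) (Primrec.nat_two_pow Primrec.snd)) (Primrec.const 2))
    (Primrec.const 1)

theorem HasNatApprox.sumStrings {α : Type} [Primcodable α] {h : α → List Bool → ℝ}
    (hh : HasNatApprox fun p : α × List Bool => h p.1 p.2) {L : α → ℕ} (hL : Computable L) :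
    HasNatApprox fun x => sumStrings (L x) (h x) := by
  simp only [sumStrings_eq_sum_range]
  exact HasNatApprox.sum_range (g := fun x i => h x (digitString (L x) i)) (hh.comp
    (Computable.pair Computable.fst (primrec_digitString.to_comp.comp
      (hL.comp Computable.fst) Computable.snd))) (Computable.nat_two_pow hL)

theorem HasNatApprox.ite_zero {α : Type} [Primcodable α] {g : α → ℝ} (hg : HasNatApprox g)
    {c : α → Prop} [DecidablePred c] (hc : Computable fun x => decide (c x)) :
    HasNatApprox fun x => if c x then g x else 0 := by
  have := hg.mul_dyadic (Computable.ite' hc (Computable.const 1) (Computable.const 0))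
    (Computable.const 0)
  convert this using 2 with x
  split_ifs <;> simp

/-! ### Image of a martingale under a map of sequences -/

section Pushforward

/-- The martingale of the image of the measure of `D` under the map on infinite binary sequences
whose value at `σ` has the `p`-th bit `g p (σ ↾ L p)`. -/
noncomputable def pushforwardMartingale (D : List Bool → ℝ) (L : ℕ → ℕ)
    (g : ℕ → List Bool → Bool) (τ : List Bool) : ℝ :=
  (sumStrings (L τ.length) fun σ =>
    if ∀ p < τ.length, g p (σ.take (L p)) = τ.getD p false then D σ else 0) *
    (((2 ^ τ.length : ℕ) : ℝ) / 2 ^ L τ.length)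

variable {D : List Bool → ℝ} {L : ℕ → ℕ} {g : ℕ → List Bool → Bool}

theorem forall_getD_append_singleton (x : ℕ → Bool) (τ : List Bool) (b : Bool) :
    (∀ p < (τ ++ [b]).length, x p = (τ ++ [b]).getD p false) ↔
      (∀ p < τ.length, x p = τ.getD p false) ∧ x τ.length = b := by
  rw [List.length_append, List.length_singleton, Nat.forall_lt_succ_right]
  refine and_congr (forall₂_congr fun p hp => ?_) ?_
  · rw [List.getD_append _ _ _ _ hp]
  · simp

theorem IsBettingMartingale.pushforwardMartingale (hD : IsBettingMartingale D) (hL : Monotone L)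
    (g : ℕ → List Bool → Bool) : IsBettingMartingale (pushforwardMartingale D L g) where
  nonneg τ := mul_nonneg (sumStrings_nonneg fun σ => by
    split_ifs
    exacts [hD.nonneg σ, le_rfl]) (by positivity)
  fair τ := by
    obtain ⟨r, hr⟩ := Nat.exists_eq_add_of_le (hL (Nat.le_succ τ.length))
    simp only [_root_.pushforwardMartingale, forall_getD_append_singleton]
    simp only [List.length_append, List.length_singleton]
    rw [← add_mul, ← sumStrings_add]
    -- Each string satisfying the conditions for `τ` belongs to exactly one of its two children, and
    -- the fairness of `D` evaluates the sum over the `r` additional input bits.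
    have h1 : sumStrings (L (τ.length + 1)) (fun σ =>
        (if (∀ p < τ.length, g p (σ.take (L p)) = τ.getD p false) ∧
          g τ.length (σ.take (L τ.length)) = false then D σ else 0) +
        (if (∀ p < τ.length, g p (σ.take (L p)) = τ.getD p false) ∧
          g τ.length (σ.take (L τ.length)) = true then D σ else 0)) =
        2 ^ r * sumStrings (L τ.length) (fun σ =>
          if ∀ p < τ.length, g p (σ.take (L p)) = τ.getD p false then D σ else 0) := by
      rw [← Nat.succ_eq_add_one, hr, sumStrings_append, ← sumStrings_mul_left]
      refine sumStrings_congr fun ρ hρ => ?_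
      have h2 : ∀ ρ', ∀ p ≤ τ.length, (ρ ++ ρ').take (L p) = ρ.take (L p) := fun ρ' p hp =>
        List.take_append_of_le_length (by rw [hρ]; exact hL hp)
      by_cases hc : ∀ p < τ.length, g p (ρ.take (L p)) = τ.getD p false
      · rw [if_pos hc, ← hD.sumStrings_eq r ρ]
        refine sumStrings_congr fun ρ' _ => ?_
        have hc' : ∀ p < τ.length, g p ((ρ ++ ρ').take (L p)) = τ.getD p false := fun p hp => by
          rw [h2 ρ' p hp.le]; exact hc p hp
        cases g τ.length ((ρ ++ ρ').take (L τ.length))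
        · rw [if_pos ⟨hc', rfl⟩, if_neg fun H => Bool.noConfusion H.2, add_zero]
        · rw [if_neg fun H => Bool.noConfusion H.2, if_pos ⟨hc', rfl⟩, zero_add]
      · rw [if_neg hc, mul_zero]
        refine (sumStrings_congr fun ρ' _ => ?_).trans
          ((sumStrings_const 0 r).trans (mul_zero _))
        have hc' : ¬ ∀ p < τ.length, g p ((ρ ++ ρ').take (L p)) = τ.getD p false := fun H =>
          hc fun p hp => by rw [← h2 ρ' p hp.le]; exact H p hp
        rw [if_neg fun H => hc' H.1, if_neg fun H => hc' H.1, add_zero]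
    rw [h1, ← Nat.succ_eq_add_one, hr, pow_add, Nat.succ_eq_add_one]
    push_cast
    field_simp
    ring

theorem HasNatApprox.pushforwardMartingale (hD : HasNatApprox D) (hL : Computable L)
    (hg : Computable₂ g) : HasNatApprox (pushforwardMartingale D L g) := by
  have hlen : Computable fun τ : List Bool => τ.length := Computable.list_length
  refine HasNatApprox.mul_dyadic (HasNatApprox.sumStrings (α := List Bool)
    (h := fun τ σ => if ∀ p < τ.length, g p (σ.take (L p)) = τ.getD p false then D σ else 0)
    (HasNatApprox.ite_zero (hD.comp Computable.snd) ?_) (hL.comp hlen))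
    (Computable.nat_two_pow hlen) (hL.comp hlen)
  refine Computable.decide_forall_lt (hlen.comp Computable.fst)
    (Computable.decide_eq (hg.comp Computable.snd (Computable.list_take'
      (hL.comp Computable.snd) (Computable.snd.comp Computable.fst))) ?_)
  exact Computable.list_getD' _ (Computable.fst.comp Computable.fst) Computable.snd

/-- If all extensions of `ρ` are mapped to extensions of `τ`, then the capital of the image
martingale at `τ` is at least that of `D` at `ρ` times the quotient of the measures. -/
theorem le_pushforwardMartingale (hD : IsBettingMartingale D) {ρ τ : List Bool}
    (hρ : ρ.length ≤ L τ.length)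
    (h : ∀ σ, (ρ ++ σ).length = L τ.length →
      ∀ p < τ.length, g p ((ρ ++ σ).take (L p)) = τ.getD p false) :
    D ρ * (2 ^ τ.length / 2 ^ ρ.length) ≤ pushforwardMartingale D L g τ := by
  obtain ⟨r, hr⟩ := Nat.exists_eq_add_of_le hρ
  have h1 : 2 ^ r * D ρ ≤ sumStrings (L τ.length) fun σ =>
      if ∀ p < τ.length, g p (σ.take (L p)) = τ.getD p false then D σ else 0 := by
    rw [hr, sumStrings_append, ← hD.sumStrings_eq r ρ]
    refine le_trans (le_of_eq (sumStrings_congr fun σ hσ => ?_)) (le_sumStrings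
      (h := fun ρ => sumStrings r fun ρ' =>
        if ∀ p < τ.length, g p ((ρ ++ ρ').take (L p)) = τ.getD p false then D (ρ ++ ρ') else 0)
      (fun σ => sumStrings_nonneg fun σ' => ?_) ρ)
    · rw [if_pos (h σ (by simp [hr, hσ]))]
    · split_ifs
      exacts [hD.nonneg _, le_rfl]
  rw [pushforwardMartingale]
  calc D ρ * (2 ^ τ.length / 2 ^ ρ.length)
      = 2 ^ r * D ρ * (((2 ^ τ.length : ℕ) : ℝ) / 2 ^ L τ.length) := by
        rw [hr, pow_add]; push_cast; field_simp
    _ ≤ _ := by gcongr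

end Pushforward

/-! ### A Borel–Cantelli test by a martingale -/

/-- The conditional probability, given `τ`, of the set of sequences whose initial segment of
length `l` has the property `P`. -/
noncomputable def condProb (l : ℕ) (P : List Bool → Prop) [DecidablePred P] (τ : List Bool) : ℝ :=
  (sumStrings l fun ρ => if P ((τ ++ ρ).take l) then ((1 : ℕ) : ℝ) else 0) *
    (((1 : ℕ) : ℝ) / 2 ^ l)

section condProb

variable (l : ℕ) (P : List Bool → Prop) [DecidablePred P]

theorem condProb_nonneg (τ : List Bool) : 0 ≤ condProb l P τ :=
  mul_nonneg (sumStrings_nonneg fun _ => by split_ifs <;> positivity) (by positivity)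

theorem condProb_fair (τ : List Bool) :
    condProb l P (τ ++ [false]) + condProb l P (τ ++ [true]) = 2 * condProb l P τ := by
  unfold condProb
  rw [← add_mul, ← mul_assoc]
  congr 1
  simp only [List.append_assoc, List.singleton_append]
  set h : List Bool → ℝ := fun σ => if P (σ.take l) then ((1 : ℕ) : ℝ) else 0 with hh
  change sumStrings (l + 1) (fun ρ => h (τ ++ ρ)) = 2 * sumStrings l (fun ρ => h (τ ++ ρ))
  rw [sumStrings_append, ← sumStrings_mul_left]
  refine sumStrings_congr fun ρ hρ => ?_
  have : ∀ ρ', h (τ ++ (ρ ++ ρ')) = h (τ ++ ρ) := fun ρ' => by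
    simp only [hh]
    rw [← List.append_assoc, List.take_append_of_le_length (by simp [hρ])]
  simp only [this, sumStrings_const, pow_one]

theorem condProb_le (τ : List Bool) : condProb l P τ ≤ 2 ^ τ.length * condProb l P [] := by
  induction τ using List.reverseRecOn with
  | nil => simp
  | append_singleton τ b ih =>
    have h := condProb_fair l P τ
    have h0 := condProb_nonneg l P (τ ++ [false])
    have h1 := condProb_nonneg l P (τ ++ [true])
    rw [List.length_append, List.length_singleton, pow_succ]
    cases b <;> linarith

theorem condProb_eq_one {τ : List Bool} (hl : l ≤ τ.length) (hP : P (τ.take l)) :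
    condProb l P τ = 1 := by
  unfold condProb
  simp only [List.take_append_of_le_length hl, if_pos hP, sumStrings_const]
  push_cast
  field_simp

theorem condProb_nil :
    condProb l P [] = (sumStrings l fun ρ => if P ρ then 1 else 0) / 2 ^ l := by
  unfold condProb
  rw [sumStrings_congr (h' := fun ρ => if P ρ then 1 else 0) fun ρ hρ => by
    rw [List.nil_append, List.take_of_length_le hρ.le, Nat.cast_one]]
  rw [Nat.cast_one, mul_one_div]

end condProb

/-- A computable sequence of clopen sets with exponentially decreasing measures can contain
a computably random sequence only finitely often. -/
theorem IsComputablyRandomSeq.eventually_not {W : ℕ → Bool} (hW : IsComputablyRandomSeq W)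
    {l : ℕ → ℕ} (hl : Computable l) {P : ℕ → List Bool → Prop} [∀ t, DecidablePred (P t)]
    (hP : Computable fun x : ℕ × List Bool => decide (P x.1 x.2)) {c : ℕ}
    (hc : ∀ t, (sumStrings (l t) fun ρ => if P t ρ then 1 else 0) / 2 ^ l t ≤
      2 ^ c * (1 / 2) ^ t) :
    ∀ᶠ t in Filter.atTop, ¬ P t (initialSegment W (l t)) := by
  -- The capital is the expected number of events that occur, given the bits seen so far; once `m`
  -- events have been decided positively it is at least `m`.
  set d : List Bool → ℝ := fun τ => ∑' t, condProb (l t) (P t) τ with hd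
  have hle : ∀ τ t, condProb (l t) (P t) τ ≤ 2 ^ (τ.length + c) * (1 / 2) ^ t := fun τ t => by
    refine (condProb_le _ _ τ).trans ?_
    rw [pow_add, mul_assoc, condProb_nil]
    gcongr
    exact hc t
  have hs : ∀ τ, Summable fun t => condProb (l t) (P t) τ := fun τ =>
    Summable.of_nonneg_of_le (fun t => condProb_nonneg _ _ _) (hle τ)
      (summable_geometric_two.mul_left _)
  have hmart : IsBettingMartingale d :=
    ⟨fun τ => tsum_nonneg fun t => condProb_nonneg _ _ _, fun τ => by
      simp only [hd]
      rw [← (hs _).tsum_add (hs _), ← tsum_mul_left]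
      exact tsum_congr fun t => condProb_fair _ _ _⟩
  have happ : HasNatApprox d := by
    have hlt : Computable fun p : List Bool × ℕ => l p.2 := hl.comp Computable.snd
    refine HasNatApprox.tsum (c := fun τ => τ.length + c) ?_
      (Computable.nat_add' Computable.list_length (Computable.const c))
      (fun τ t => condProb_nonneg _ _ _) hle
    refine HasNatApprox.mul_dyadic (HasNatApprox.sumStrings (α := List Bool × ℕ)
      (h := fun p ρ => if P p.2 ((p.1 ++ ρ).take (l p.2)) then ((1 : ℕ) : ℝ) else 0) ?_ hlt)
      (Computable.const 1) hlt
    refine HasNatApprox.ite_zero (HasNatApprox.natCast (Computable.const 1)) ?_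
    have h1 : Computable fun x : (List Bool × ℕ) × List Bool => x.1.2 :=
      Computable.snd.comp Computable.fst
    exact hP.comp (Computable.pair h1 (Computable.list_take' (hl.comp h1)
      (Computable.list_append.comp (Computable.fst.comp Computable.fst) Computable.snd)))
  by_contra hcon
  have hinf : {t | P t (initialSegment W (l t))}.Infinite := by
    rw [← Nat.frequently_atTop_iff_infinite]
    simpa [Filter.Frequently] using hcon
  refine hW d hmart happ.uniformlyComputable fun C => ?_
  obtain ⟨m, hm⟩ := exists_nat_gt C
  obtain ⟨T, hT, hTm⟩ := hinf.exists_subset_card_eq m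
  refine ⟨T.sup l, hm.trans_le ?_⟩
  calc (m : ℝ) = ∑ t ∈ T, condProb (l t) (P t) (initialSegment W (T.sup l)) := by
        rw [Finset.sum_congr rfl fun t ht => condProb_eq_one (l t) (P t) ?_ ?_]
        · simp [hTm]
        · rw [length_initialSegment]; exact Finset.le_sup ht
        · rw [take_initialSegment W (Finset.le_sup ht)]; exact hT ht
    _ ≤ d (initialSegment W (T.sup l)) :=
        (hs _).sum_le_tsum _ fun t _ => condProb_nonneg _ _ _

/-! ### Constant blocks of digits are rare -/

/-- Among the bits of `σ`, read as an interleaving of `n` sequences, some sequence is constant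
on `[o, o + c)`. -/
def HasConstantBlock (n c o : ℕ) (σ : List Bool) : Prop :=
  ∃ i < n, ∃ b, ∀ q < c, σ.getD (n * (o + q) + i) false = b

instance (n c o : ℕ) : DecidablePred (HasConstantBlock n c o) := fun σ =>
  inferInstanceAs (Decidable (∃ i < n, ∃ b, ∀ q < c, σ.getD (n * (o + q) + i) false = b))

theorem computable_hasConstantBlock (n : ℕ) :
    Computable fun x : (ℕ × ℕ) × List Bool => decide (HasConstantBlock n x.1.1 x.1.2 x.2) := by
  have h (b : Bool) : Computable fun y : ((ℕ × ℕ) × List Bool) × ℕ =>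
      decide (∀ q < y.1.1.1, y.1.2.getD (n * (y.1.1.2 + q) + y.2) false = b) := by
    refine Computable.decide_forall_lt
      (Computable.fst.comp (Computable.fst.comp Computable.fst))
      (Computable.decide_eq (Computable.list_getD' _
        (Computable.snd.comp (Computable.fst.comp Computable.fst)) ?_) (Computable.const b))
    exact Computable.nat_add' (Computable.nat_mul' (Computable.const n)
      (Computable.nat_add' (Computable.snd.comp
        (Computable.fst.comp (Computable.fst.comp Computable.fst))) Computable.snd))
      (Computable.snd.comp Computable.fst)
  have hor : Computable₂ fun (x : (ℕ × ℕ) × List Bool) (i : ℕ) =>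
      decide (¬ ∃ b, ∀ q < x.1.1, x.2.getD (n * (x.1.2 + q) + i) false = b) := by
    refine (Primrec.not.to_comp.comp (Primrec.or.to_comp.comp (h false) (h true))).of_eq
      fun y => ?_
    simp only [Bool.exists_bool]
    rw [← Bool.decide_or, ← decide_not]
  refine (Primrec.not.to_comp.comp (Computable.decide_forall_lt
    (Computable.const n) hor)).of_eq fun x => ?_
  rw [← decide_not, decide_eq_decide]
  simp only [HasConstantBlock, not_forall, not_not, exists_prop]

theorem hasConstantBlock_append {n c o : ℕ} {ρ : List Bool} (hρ : ρ.length = n * o)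
    (σ : List Bool) : HasConstantBlock n c o (ρ ++ σ) ↔ HasConstantBlock n c 0 σ := by
  unfold HasConstantBlock
  have : ∀ q i, (ρ ++ σ).getD (n * (o + q) + i) false = σ.getD (n * (0 + q) + i) false := by
    intro q i
    have e : n * (o + q) + i = ρ.length + (n * (0 + q) + i) := by rw [hρ]; ring
    rw [e, List.getD_append_right _ _ _ _ (by omega), Nat.add_sub_cancel_left]
  simp only [this]

theorem sumStrings_getD_eq (b : Bool) : ∀ {n i : ℕ}, i < n →
    (sumStrings n fun ρ => if ρ.getD i false = b then 1 else 0) = 2 ^ n / 2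
  | n + 1, 0, _ => by
    simp only [sumStrings, List.getD_cons_zero]
    rw [sumStrings_const, sumStrings_const]
    cases b <;> simp [pow_succ]
  | n + 1, i + 1, h => by
    simp only [sumStrings, List.getD_cons_succ]
    rw [sumStrings_getD_eq b (Nat.lt_of_succ_lt_succ h)]
    ring

/-- The `c` prescribed bits lie in distinct rows of `n` bits, and each row contributes an
independent factor `1 / 2`. -/
theorem sumStrings_constant (b : Bool) {n i : ℕ} (hi : i < n) (c : ℕ) :
    (sumStrings (n * c) fun ρ => if ∀ q < c, ρ.getD (n * (0 + q) + i) false = b then 1 else 0) =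
      2 ^ (n * c) / 2 ^ c := by
  induction c with
  | zero => simp [sumStrings]
  | succ c ih =>
    rw [Nat.mul_succ, sumStrings_append, pow_add, pow_succ, mul_div_mul_comm, ← ih,
      mul_comm (sumStrings (n * c) _), ← sumStrings_mul_left]
    refine sumStrings_congr fun ρ hρ => ?_
    rw [← sumStrings_getD_eq b hi, mul_comm (sumStrings n _), ← sumStrings_mul_left]
    refine sumStrings_congr fun ρ' _ => ?_
    have h1 : (∀ q < c + 1, (ρ ++ ρ').getD (n * (0 + q) + i) false = b) ↔
        (∀ q < c, ρ.getD (n * (0 + q) + i) false = b) ∧ ρ'.getD i false = b := by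
      rw [Nat.forall_lt_succ_right]
      refine and_congr (forall₂_congr fun q hq => ?_) ?_
      · rw [List.getD_append]
        rw [hρ]
        calc n * (0 + q) + i < n * (0 + q) + n := by omega
          _ = n * (q + 1) := by ring
          _ ≤ n * c := Nat.mul_le_mul_left _ hq
      · rw [List.getD_append_right _ _ _ _ (by rw [hρ, zero_add]; omega), hρ, zero_add,
          Nat.add_sub_cancel_left]
    simp only [h1, ite_and]
    split_ifs <;> simp

/-- Union bound over the `n` coordinates and the two values of the constant. -/
theorem sumStrings_hasConstantBlock_le (n c : ℕ) :
    (sumStrings (n * c) fun ρ => if HasConstantBlock n c 0 ρ then 1 else 0) ≤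
      2 ^ (n * c) * (2 * n / 2 ^ c) := by
  calc _ ≤ sumStrings (n * c) fun ρ => ∑ i ∈ Finset.range n, ∑ b : Bool,
          if ∀ q < c, ρ.getD (n * (0 + q) + i) false = b then (1 : ℝ) else 0 := by
        refine sumStrings_mono fun ρ _ => ?_
        split_ifs with h
        · obtain ⟨i, hi, b, hb⟩ := h
          refine le_trans ?_ (Finset.single_le_sum (f := fun i => ∑ b : Bool,
            if ∀ q < c, ρ.getD (n * (0 + q) + i) false = b then (1 : ℝ) else 0)
            (fun i _ => by positivity) (Finset.mem_range.2 hi))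
          refine le_trans ?_ (Finset.single_le_sum (f := fun b =>
            if ∀ q < c, ρ.getD (n * (0 + q) + i) false = b then (1 : ℝ) else 0)
            (fun i _ => by positivity) (Finset.mem_univ b))
          simp only [if_pos hb, le_refl]
        · positivity
    _ = ∑ i ∈ Finset.range n, ∑ b : Bool, (2 : ℝ) ^ (n * c) / 2 ^ c := by
        rw [sumStrings_sum]
        refine Finset.sum_congr rfl fun i hi => ?_
        rw [sumStrings_sum]
        exact Finset.sum_congr rfl fun b _ => sumStrings_constant b (Finset.mem_range.1 hi) c
    _ = _ := by simp; ring

theorem hasConstantBlock_initialSegment {W : ℕ → Bool} {n c o k : ℕ} (hk : n * (o + c) ≤ k) :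
    HasConstantBlock n c o (initialSegment W k) ↔
      ∃ i < n, ∃ b, ∀ q < c, W (n * (o + q) + i) = b := by
  refine exists_congr fun i => and_congr_right fun hi => exists_congr fun b =>
    forall₂_congr fun q hq => ?_
  rw [getD_initialSegment]
  calc n * (o + q) + i < n * (o + q) + n := by omega
    _ = n * (o + (q + 1)) := by ring
    _ ≤ n * (o + c) := Nat.mul_le_mul_left _ (by omega)
    _ ≤ k := hk

/-- In a computably random interleaving of `n` sequences, eventually none of the sequences is
constant on `[j + 1, 3 j + 1)`. -/
theorem IsComputablyRandomSeq.eventually_not_constant {W : ℕ → Bool}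
    (hW : IsComputablyRandomSeq W) (n : ℕ) : ∀ᶠ j in Filter.atTop,
      ¬ ∃ i < n, ∃ b, ∀ q < 2 * j, W (n * (j + 1 + q) + i) = b := by
  have hj : Computable fun j : ℕ => j + 1 := Computable.succ
  have h2 : Computable fun j : ℕ => 2 * j := Computable.nat_mul' (Computable.const 2) Computable.id
  have h := hW.eventually_not (l := fun j => n * (j + 1) + n * (2 * j))
    (P := fun j => HasConstantBlock n (2 * j) (j + 1)) (c := n + 1)
    (Computable.nat_add' (Computable.nat_mul' (Computable.const n) hj)
      (Computable.nat_mul' (Computable.const n) h2))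
    ((computable_hasConstantBlock n).comp (Computable.pair (Computable.pair
      (h2.comp Computable.fst) (hj.comp Computable.fst)) Computable.snd)) fun t => ?_
  · filter_upwards [h] with j hj
    rwa [hasConstantBlock_initialSegment (by rw [mul_add])] at hj
  · rw [sumStrings_append, div_le_iff₀ (by positivity)]
    calc _ ≤ sumStrings (n * (t + 1)) fun _ =>
            (2 : ℝ) ^ (n * (2 * t)) * (2 * n / 2 ^ (2 * t)) := by
          refine sumStrings_mono fun ρ hρ => ?_
          simp only [hasConstantBlock_append hρ]
          exact sumStrings_hasConstantBlock_le n (2 * t)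
      _ = (2 * n / 2 ^ (2 * t)) * 2 ^ (n * (t + 1) + n * (2 * t)) := by
          rw [sumStrings_const, pow_add]; ring
      _ ≤ _ := by
          gcongr
          have h1 : (n : ℝ) ≤ 2 ^ n := by exact_mod_cast Nat.lt_two_pow_self.le
          have h2 : (1 : ℝ) ≤ 2 ^ t := one_le_pow₀ (by norm_num)
          rw [one_div, inv_pow, two_mul t, pow_add 2 t t, pow_succ 2 n, div_le_iff₀ (by positivity)]
          field_simp
          nlinarith [mul_le_mul h1 h2 zero_le_one (by positivity)]

/-- In a computably random interleaving of `n` sequences, there are arbitrarily late blocks of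
length `n + 2` on which none of the sequences is constant. -/
theorem IsComputablyRandomSeq.exists_not_constant {W : ℕ → Bool}
    (hW : IsComputablyRandomSeq W) (n o : ℕ) : ∃ o' ≥ o,
      ¬ ∃ i < n, ∃ b, ∀ q < n + 2, W (n * (o' + q) + i) = b := by
  by_contra! hcon
  set c := n + 2 with hc
  have ho : Computable fun s : ℕ => o + c * s :=
    Computable.nat_add' (Computable.const o) (Computable.nat_mul' (Computable.const c) Computable.id)
  -- Event `t`: the first `t` consecutive blocks of length `c` after `o` all have a constant
  -- coordinate. The blocks are disjoint, hence independent, and each has probability at most `1 /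
  -- 2`.
  have h := hW.eventually_not (l := fun t => n * (o + c * t))
    (P := fun t σ => ∀ s < t, HasConstantBlock n c (o + c * s) σ) (c := 0)
    (Computable.nat_mul' (Computable.const n) ho)
    (Computable.decide_forall_lt Computable.fst ((computable_hasConstantBlock n).comp
      (Computable.pair (Computable.pair (Computable.const c) (ho.comp Computable.snd))
        (Computable.snd.comp Computable.fst)))) fun t => ?_
  · obtain ⟨t, ht⟩ := h.exists
    refine ht fun s hs => ?_
    refine (hasConstantBlock_initialSegment (Nat.mul_le_mul_left _ ?_)).2 (hcon _ (by omega))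
    calc o + c * s + c = o + c * (s + 1) := by ring
      _ ≤ o + c * t := by gcongr; omega
  · rw [div_le_iff₀ (by positivity), pow_zero, one_mul]
    induction t with
    | zero => simp [sumStrings_const]
    | succ t ih =>
      have e : n * (o + c * (t + 1)) = n * (o + c * t) + n * c := by ring
      rw [e, sumStrings_append]
      -- The choice `c = n + 2` is made for this: `2 * n / 2 ^ (n + 2) ≤ 1 / 2` because `n ≤ 2 ^ n`.
      have hb : (2 : ℝ) * n / 2 ^ c ≤ 1 / 2 := by
        have h1 : (n : ℝ) ≤ 2 ^ n := by exact_mod_cast Nat.lt_two_pow_self.le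
        rw [div_le_iff₀ (by positivity), hc, pow_add]
        linarith
      calc _ ≤ sumStrings (n * (o + c * t)) fun ρ =>
            (2 : ℝ) ^ (n * c) * (1 / 2) *
              if ∀ s < t, HasConstantBlock n c (o + c * s) ρ then 1 else 0 := by
            refine sumStrings_mono fun ρ hρ => ?_
            split_ifs with hP
            · calc _ ≤ sumStrings (n * c) fun ρ' =>
                    if HasConstantBlock n c 0 ρ' then (1 : ℝ) else 0 := by
                    refine sumStrings_mono fun ρ' _ => ?_
                    by_cases h1 : HasConstantBlock n c 0 ρ'
                    · rw [if_pos h1]; split_ifs <;> norm_num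
                    · rw [if_neg h1, if_neg fun H => h1 ?_]
                      exact (hasConstantBlock_append hρ ρ').1 (H t (Nat.lt_succ_self t))
                _ ≤ 2 ^ (n * c) * (2 * n / 2 ^ c) := sumStrings_hasConstantBlock_le n c
                _ ≤ _ := by rw [mul_one]; gcongr
            · rw [mul_zero]
              refine le_of_eq ?_
              refine (sumStrings_congr fun ρ' _ => ?_).trans
                ((sumStrings_const 0 _).trans (mul_zero _))
              rw [if_neg fun H => hP fun s hs => ?_]
              have h2 := H s (by omega)
              obtain ⟨i, hi, b, hb⟩ := h2
              refine ⟨i, hi, b, fun q hq => ?_⟩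
              rw [← hb q hq, List.getD_append]
              rw [hρ]
              calc n * (o + c * s + q) + i < n * (o + c * s + q) + n := by omega
                _ = n * (o + c * s + (q + 1)) := by ring
                _ ≤ n * (o + c * s + c) := by gcongr; omega
                _ = n * (o + c * (s + 1)) := by ring
                _ ≤ n * (o + c * t) := by gcongr; omega
        _ = (2 : ℝ) ^ (n * c) * (1 / 2) * sumStrings (n * (o + c * t)) fun ρ =>
              if ∀ s < t, HasConstantBlock n c (o + c * s) ρ then 1 else 0 :=
            sumStrings_mul_left _ _ _
        _ ≤ 2 ^ (n * c) * (1 / 2) * ((1 / 2) ^ t * 2 ^ (n * (o + c * t))) := by gcongr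
        _ = _ := by rw [pow_add, pow_succ]; ring

/-! ### Binary digits and their stability under approximation -/

theorem floor_mul_two_pow (x : ℝ) (m r : ℕ) : ⌊x * 2 ^ m⌋ = ⌊x * 2 ^ (m + r)⌋ / 2 ^ r := by
  have h := Int.floor_div_natCast (x * 2 ^ (m + r)) (2 ^ r)
  push_cast at h
  rw [← h, pow_add]
  congr 1
  field_simp

theorem digits_fract_eq_one_iff (x : ℝ) (j : ℕ) :
    Real.digits (Int.fract x) 2 j = 1 ↔ ⌊x * 2 ^ (j + 1)⌋ % 2 = 1 := by
  have h0 : 0 ≤ Int.fract x * 2 ^ (j + 1) := mul_nonneg (Int.fract_nonneg x) (by positivity)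
  have h1 : ⌊x * 2 ^ (j + 1)⌋ = ⌊Int.fract x * 2 ^ (j + 1)⌋ + 2 * (⌊x⌋ * 2 ^ j) := by
    rw [← Int.floor_add_intCast]
    congr 1
    push_cast
    rw [Int.fract]
    ring
  have h2 : ((⌊Int.fract x * 2 ^ (j + 1)⌋₊ : ℕ) : ℤ) = ⌊Int.fract x * 2 ^ (j + 1)⌋ :=
    Int.natCast_floor_eq_floor h0
  rw [h1, ← h2, Real.digits, Fin.ext_iff]
  simp only [Fin.ofNat, Fin.val_one, Nat.cast_ofNat]
  omega

theorem binaryExpansion_mul_add {n : ℕ} [NeZero n] (z : EuclideanSpace ℝ (Fin n)) (j : ℕ)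
    (i : Fin n) :
    binaryExpansion z (n * j + i) = decide (⌊z i * 2 ^ (j + 1)⌋ % 2 = 1) := by
  have h1 : Fin.ofNat n (n * j + i) = i := by
    ext
    simp [Fin.ofNat, Nat.mod_eq_of_lt i.2]
  have h2 : (n * j + i) / n = j := by
    rw [Nat.mul_add_div (NeZero.pos n), Nat.div_eq_of_lt i.2, add_zero]
  rw [binaryExpansion, h1, h2, decide_eq_decide, digits_fract_eq_one_iff]

/-- If the binary digits of `x` in `[o, o + c)` are neither all `0` nor all `1`, then all points
close to `x` have the same first `o` digits. -/
theorem floor_eq_of_not_constant {x a : ℝ} {o c : ℕ}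
    (h : ¬ ∃ b, ∀ q < c, decide (⌊x * 2 ^ (o + q + 1)⌋ % 2 = 1) = b)
    (ha : |a - x| ≤ (2 ^ (o + c))⁻¹) : ⌊a * 2 ^ o⌋ = ⌊x * 2 ^ o⌋ := by
  set N := ⌊x * 2 ^ (o + c)⌋ with hN
  have hcpos : (0 : ℤ) < 2 ^ c := by positivity
  have hbit : ∀ q < c, ∃ s, (2 : ℤ) ^ c = 2 ^ s * (2 * 2 ^ q) ∧
      ⌊x * 2 ^ (o + q + 1)⌋ = N / 2 ^ s := fun q hq => by
    refine ⟨c - (q + 1), ?_, ?_⟩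
    · rw [← pow_succ', ← pow_add, Nat.sub_add_cancel hq]
    · rw [floor_mul_two_pow x (o + q + 1) (c - (q + 1)), hN,
        show o + q + 1 + (c - (q + 1)) = o + c by omega]
  have hdiv := Int.emod_add_mul_ediv N (2 ^ c)
  have hr0 := Int.emod_nonneg N hcpos.ne'
  have hr1 := Int.emod_lt_of_pos N hcpos
  -- The last `c` binary digits of `N` are the digits of `x` in the block. As they are not constant,
  -- `N - 1` and `N + 1` have the same quotient by `2 ^ c` as `N`, and the scaled floor of `a` is
  -- one of these three integers.
  have hlow : N % 2 ^ c ≠ 0 := fun h0 => h ⟨false, fun q hq => by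
    obtain ⟨s, hs, hx⟩ := hbit q hq
    have h1 : N = 2 ^ s * (2 * (2 ^ q * (N / 2 ^ c))) := by
      rw [h0, hs] at hdiv
      rw [hs]
      linear_combination -hdiv
    rw [hx, h1, Int.mul_ediv_cancel_left _ (by positivity)]
    simp⟩
  have hhigh : N % 2 ^ c ≠ 2 ^ c - 1 := fun h0 => h ⟨true, fun q hq => by
    obtain ⟨s, hs, hx⟩ := hbit q hq
    have hspos : (0 : ℤ) < 2 ^ s := by positivity
    have h1 : N = (2 ^ s - 1) + 2 ^ s * (2 * (2 ^ q * (N / 2 ^ c + 1)) - 1) := by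
      rw [h0, hs] at hdiv
      rw [hs]
      linear_combination -hdiv
    rw [hx, h1, Int.add_mul_ediv_left _ _ hspos.ne', Int.ediv_eq_zero_of_lt (by omega) (by omega)]
    simp only [decide_eq_true_eq]
    omega⟩
  have ha' : |a * 2 ^ (o + c) - x * 2 ^ (o + c)| ≤ 1 := by
    rw [← sub_mul, abs_mul, abs_of_pos (by positivity : (0 : ℝ) < 2 ^ (o + c))]
    calc _ ≤ (2 ^ (o + c) : ℝ)⁻¹ * 2 ^ (o + c) := by gcongr
      _ = 1 := by field_simp
  have ha' := abs_le.1 ha'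
  have hx1 := Int.floor_le (x * 2 ^ (o + c))
  have hx2 := Int.lt_floor_add_one (x * 2 ^ (o + c))
  rw [← hN] at hx1 hx2
  have l1 : N - 1 ≤ ⌊a * 2 ^ (o + c)⌋ := Int.le_floor.2 (by push_cast; linarith)
  have l2 : ⌊a * 2 ^ (o + c)⌋ < N + 2 := Int.floor_lt.2 (by push_cast; linarith)
  rw [floor_mul_two_pow a o c, floor_mul_two_pow x o c, ← hN]
  have h3 : ⌊a * 2 ^ (o + c)⌋ = (⌊a * 2 ^ (o + c)⌋ - N + N % 2 ^ c) + 2 ^ c * (N / 2 ^ c) := by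
    linarith
  rw [h3, Int.add_mul_ediv_left _ _ hcpos.ne', Int.ediv_eq_zero_of_lt (by omega) (by omega),
    zero_add]

/-! ### Dyadic points read off from bits, and their images -/

/-- The number whose binary digits are the first `r` bits of the `i`-th of the `n` sequences
interleaved in `ρ`. -/
def coordValue (n : ℕ) (ρ : List Bool) (i : ℕ) : ℕ → ℕ
  | 0 => 0
  | r + 1 => 2 * coordValue n ρ i r + if ρ.getD (n * r + i) false = true then 1 else 0

theorem primrec_coordValue (n i : ℕ) :
    Primrec fun x : List Bool × ℕ => coordValue n x.1 i x.2 := by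
  have hstep : Primrec₂ fun (x : List Bool × ℕ) (q : ℕ × ℕ) =>
      2 * q.2 + if x.1.getD (n * q.1 + i) false = true then 1 else 0 := by
    refine Primrec.nat_add.comp (Primrec.nat_mul.comp (Primrec.const 2)
      (Primrec.snd.comp Primrec.snd)) (Primrec.ite (Primrec.eq.comp
        ((Primrec.list_getD false).comp (Primrec.fst.comp Primrec.fst) ?_) (Primrec.const true))
        (Primrec.const 1) (Primrec.const 0))
    exact Primrec.nat_add.comp (Primrec.nat_mul.comp (Primrec.const n)
      (Primrec.fst.comp Primrec.snd)) (Primrec.const i)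
  refine (Primrec.nat_rec' Primrec.snd (Primrec.const 0) hstep).of_eq fun x => ?_
  obtain ⟨σ, k⟩ := x
  induction k with
  | zero => rfl
  | succ k ih => simp only at ih ⊢; rw [ih]; rfl

theorem coordValue_add_bounds (n : ℕ) (ρ : List Bool) (i r s : ℕ) :
    coordValue n ρ i r * 2 ^ s ≤ coordValue n ρ i (r + s) ∧
      coordValue n ρ i (r + s) < (coordValue n ρ i r + 1) * 2 ^ s := by
  induction s with
  | zero => simp
  | succ s ih =>
    rw [← Nat.add_assoc, coordValue, pow_succ, ← mul_assoc, ← mul_assoc]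
    split_ifs <;> omega

theorem coordValue_eq_floor {n : ℕ} [NeZero n] {z : EuclideanSpace ℝ (Fin n)} {ρ : List Bool}
    {i : Fin n} {r : ℕ}
    (h : ∀ q < r, ρ.getD (n * q + i) false = binaryExpansion z (n * q + i)) :
    (coordValue n ρ i r : ℤ) + ⌊z i⌋ * 2 ^ r = ⌊z i * 2 ^ r⌋ := by
  induction r with
  | zero => simp [coordValue]
  | succ r ih =>
    have ih := ih fun q hq => h q (by omega)
    have h1 := h r (by omega)
    rw [binaryExpansion_mul_add] at h1
    have h2 := floor_mul_two_pow (z i) r 1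
    have h3 : ⌊z i⌋ * 2 ^ (r + 1) = 2 * (⌊z i⌋ * 2 ^ r) := by ring
    rw [pow_one] at h2
    rw [coordValue, h1, h3]
    simp only [decide_eq_true_eq]
    push_cast
    split_ifs <;> omega

theorem abs_coordValue_sub_le {n : ℕ} [NeZero n] {z : EuclideanSpace ℝ (Fin n)} {ρ : List Bool}
    {i : Fin n} {r N : ℕ} (hr : r ≤ N)
    (h : ∀ q < r, ρ.getD (n * q + i) false = binaryExpansion z (n * q + i)) :
    |((⌊z i⌋ * 2 ^ N + coordValue n ρ i N : ℤ) : ℝ) / 2 ^ N - z i| ≤ (2 ^ r)⁻¹ := by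
  obtain ⟨s, rfl⟩ := Nat.exists_eq_add_of_le hr
  have h1 := coordValue_eq_floor h
  obtain ⟨h2, h3⟩ := coordValue_add_bounds n ρ i r s
  have h2 : (coordValue n ρ i r : ℝ) * 2 ^ s ≤ coordValue n ρ i (r + s) := by exact_mod_cast h2
  have h3 : (coordValue n ρ i (r + s) : ℝ) ≤ (coordValue n ρ i r + 1) * 2 ^ s := by
    exact_mod_cast h3.le
  have h4 := Int.floor_le (z i * 2 ^ r)
  have h5 := (Int.lt_floor_add_one (z i * 2 ^ r)).le
  rw [← h1] at h4 h5
  push_cast at h4 h5 ⊢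
  have hs : (0 : ℝ) < 2 ^ s := by positivity
  have hr : (0 : ℝ) < 2 ^ r := by positivity
  have e : ((⌊z i⌋ : ℝ) * 2 ^ (r + s) + coordValue n ρ i (r + s)) / 2 ^ (r + s) - z i =
      (⌊z i⌋ * 2 ^ r * 2 ^ s + coordValue n ρ i (r + s) - z i * 2 ^ r * 2 ^ s) /
        (2 ^ r * 2 ^ s) := by
    rw [pow_add]; field_simp
  rw [e, abs_div, abs_of_pos (mul_pos hr hs), div_le_iff₀ (mul_pos hr hs), ← mul_assoc,
    inv_mul_cancel₀ hr.ne', one_mul, abs_le]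
  have h6 := mul_le_mul_of_nonneg_right h4 hs.le
  have h7 := mul_le_mul_of_nonneg_right h5 hs.le
  constructor <;> linarith

theorem EuclideanSpace.norm_le_card_mul {n : ℕ} [NeZero n] {x : EuclideanSpace ℝ (Fin n)} {δ : ℝ}
    (hx : ∀ i, |x i| ≤ δ) : ‖x‖ ≤ n * δ := by
  have hδ : 0 ≤ δ := (abs_nonneg _).trans (hx 0)
  have hn : (1 : ℝ) ≤ n := by exact_mod_cast NeZero.one_le
  rw [EuclideanSpace.norm_eq, Real.sqrt_le_left (by positivity)]
  calc ∑ i, ‖x i‖ ^ 2 ≤ ∑ _i : Fin n, δ ^ 2 := by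
        gcongr with i; exact hx i
    _ = n * δ ^ 2 := by simp
    _ ≤ (n * δ) ^ 2 := by nlinarith [mul_nonneg (sub_nonneg.2 hn) (sq_nonneg δ)]

/-- The numerators of the coordinates of the dyadic point with denominator `2 ^ N` whose integer
part is that of `z` and whose fractional part is given by the bits of `ρ`. -/
noncomputable def dyadicNumerators {n : ℕ} (z : EuclideanSpace ℝ (Fin n)) (ρ : List Bool) (N : ℕ) :
    Fin n → ℤ :=
  fun i => ⌊z i⌋ * 2 ^ N + coordValue n ρ i N

/-- The point `z` enters only through its finitely many integer parts, which are constants of the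
algorithm. Each is written as a difference of two naturals. -/
theorem primrec_dyadicNumerators {n : ℕ} (z : EuclideanSpace ℝ (Fin n)) :
    Primrec₂ (dyadicNumerators z) := by
  refine Primrec.fin_curry.2 (Primrec₂.swap (Primrec.fin_curry₁.2 fun i => ?_))
  have hp : Primrec fun x : List Bool × ℕ => 2 ^ x.2 := Primrec.nat_two_pow Primrec.snd
  refine (Primrec.int_natCast_sub.comp (Primrec.nat_add.comp
    (Primrec.nat_mul.comp (Primrec.const ⌊z i⌋.toNat) hp) (primrec_coordValue n i))
    (Primrec.nat_mul.comp (Primrec.const (-⌊z i⌋).toNat) hp)).of_eq fun x => ?_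
  have h : ⌊z i⌋ = (⌊z i⌋.toNat : ℤ) - ((-⌊z i⌋).toNat : ℤ) := by omega
  simp only [dyadicNumerators]
  push_cast
  linear_combination (-(2 : ℤ) ^ x.2) * h

theorem norm_dyadicPoint_sub_le {n : ℕ} [NeZero n] {z : EuclideanSpace ℝ (Fin n)} {ρ : List Bool}
    {r N : ℕ} (hr : r ≤ N)
    (h : ∀ q < r, ∀ i : Fin n, ρ.getD (n * q + i) false = binaryExpansion z (n * q + i)) :
    ‖dyadicPoint (dyadicNumerators z ρ N) N - z‖ ≤ n * (2 ^ r)⁻¹ :=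
  EuclideanSpace.norm_le_card_mul fun i => abs_coordValue_sub_le hr fun q hq => h q hq i

/-- The digit number `j` of a real number is determined by any approximation that is close enough
in comparison with a nonconstant block of digits after it. -/
theorem decide_floor_eq {n : ℕ} [NeZero n] {w : EuclideanSpace ℝ (Fin n)} {a : ℝ} {o c j : ℕ}
    (h : ¬ ∃ i < n, ∃ b, ∀ q < c, binaryExpansion w (n * (o + q) + i) = b) (hj : j < o)
    {i : Fin n} (ha : |a - w i| ≤ (2 ^ (o + c))⁻¹) :
    decide (⌊a * 2 ^ (j + 1)⌋ % 2 = 1) = binaryExpansion w (n * j + i) := by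
  have h1 : ⌊a * 2 ^ o⌋ = ⌊w i * 2 ^ o⌋ := by
    refine floor_eq_of_not_constant (fun ⟨b, hb⟩ => h ⟨i, i.2, b, fun q hq => ?_⟩) ha
    rw [binaryExpansion_mul_add]
    exact hb q hq
  obtain ⟨s, rfl⟩ := Nat.exists_eq_add_of_lt hj
  rw [binaryExpansion_mul_add, floor_mul_two_pow a (j + 1) s, floor_mul_two_pow (w i) (j + 1) s,
    show j + 1 + s = j + s + 1 by omega, h1]

/-- The images under `f` of points whose first `r` binary digits are those of `z` are close
to `f z`. -/
theorem abs_approx_sub_le {n : ℕ} [NeZero n]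
    {f : EuclideanSpace ℝ (Fin n) → EuclideanSpace ℝ (Fin n)}
    {K : NNReal} (hK : LipschitzWith K f) {κ : ℕ} (hκ : K * n + 1 ≤ (2 : ℝ) ^ κ)
    {z : EuclideanSpace ℝ (Fin n)} {ρ : List Bool} {r N : ℕ} (hr : r ≤ N)
    (h : ∀ q < r, ∀ i : Fin n, ρ.getD (n * q + i) false = binaryExpansion z (n * q + i))
    {i : Fin n} {a : ℝ}
    (ha : |f (dyadicPoint (dyadicNumerators z ρ N) N) i - a| ≤ (2 ^ N)⁻¹) :
    |a - f z i| ≤ 2 ^ κ * (2 ^ r)⁻¹ := by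
  set u := dyadicPoint (dyadicNumerators z ρ N) N
  have h1 : |f u i - f z i| ≤ K * (n * (2 ^ r)⁻¹) := by
    calc |f u i - f z i| ≤ ‖f u - f z‖ := PiLp.norm_apply_le (f u - f z) i
      _ ≤ K * ‖u - z‖ := hK.norm_sub_le u z
      _ ≤ K * (n * (2 ^ r)⁻¹) := by gcongr; exact norm_dyadicPoint_sub_le hr h
  have h2 : ((2 : ℝ) ^ N)⁻¹ ≤ (2 ^ r)⁻¹ := by gcongr; norm_num
  calc |a - f z i| ≤ |a - f u i| + |f u i - f z i| := abs_sub_le _ _ _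
    _ ≤ (2 ^ r)⁻¹ + K * (n * (2 ^ r)⁻¹) := by
        rw [abs_sub_comm a]; exact add_le_add (ha.trans h2) h1
    _ = (K * n + 1) * (2 ^ r)⁻¹ := by ring
    _ ≤ _ := by gcongr

/-! ### Transporting the martingale along `f` -/

theorem mainTheorem3 (n : ℕ) [NeZero n]
    (f : EuclideanSpace ℝ (Fin n) → EuclideanSpace ℝ (Fin n))
    (hf : IsComputableMap f) (hinj : Function.Injective f)
    (hlip : ∃ K : NNReal, LipschitzWith K f)
    (z : EuclideanSpace ℝ (Fin n)) (hz : ¬ IsComputablyRandom z) :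
    ¬ IsComputablyRandom (f z) := by
  intro hW
  obtain ⟨K, hK⟩ := hlip
  obtain ⟨⟨a, hac, ha⟩, -⟩ := hf
  simp only [IsComputablyRandom, IsComputablyRandomSeq, not_forall, not_not] at hz
  obtain ⟨d, hd, hdc, hdZ⟩ := hz
  obtain ⟨D, hD, hDc, hDZ⟩ := exists_tendsto_of_succeedsOn hd hdc hdZ
  set Z := binaryExpansion z
  set W := binaryExpansion (f z)
  have hn : 0 < n := NeZero.pos n
  obtain ⟨j₀, hj₀⟩ := Filter.eventually_atTop.1 (hW.eventually_not_constant n)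
  obtain ⟨κ, hκ⟩ := pow_unbounded_of_one_lt ((K : ℝ) * n + 1) (by norm_num : (1 : ℝ) < 2)
  -- Output bit `p` is digit `j = p / n ≤ p` of a coordinate. After the loss of `κ` bits in
  -- `abs_approx_sub_le`, `3 * p + 1` bits remain, enough to reach the end of the block `[j + 1, 3 j
  -- + 1)`.
  set N : ℕ → ℕ := fun p => 3 * p + 1 + κ with hN
  set L : ℕ → ℕ := fun p => n * N p
  set A : ℕ → List Bool → ℤ := fun p ρ =>
    a ((dyadicNumerators z ρ (N p), N p), Fin.ofNat n p) (N p)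
  -- The blocks are known to be nonconstant only for `j ≥ j₀`, so the finitely many earlier bits of
  -- `W` are hard-coded.
  set g : ℕ → List Bool → Bool := fun p ρ =>
    if p < n * j₀ then (initialSegment W (n * j₀)).getD p false
    else decide (A p ρ / 2 ^ (N p - (p / n + 1)) % 2 = 1) with hg
  have hNc : Computable N := Computable.nat_add' (Computable.nat_add' (Computable.nat_mul'
    (Computable.const 3) Computable.id) (Computable.const 1)) (Computable.const κ)
  have hLc : Computable L := Computable.nat_mul' (Computable.const n) hNc
  have hN1 : Computable fun x : ℕ × List Bool => N x.1 := hNc.comp Computable.fst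
  have hofNat : Computable (Fin.ofNat n) :=
    (Primrec.fin_val_iff.1 (Primrec.nat_mod.comp Primrec.id (Primrec.const n))).to_comp
  have hAc : Computable₂ A := hac.comp (Computable.pair (Computable.pair
    ((primrec_dyadicNumerators z).to_comp.comp Computable.snd hN1) hN1)
    (hofNat.comp Computable.fst)) hN1
  have hgc : Computable₂ g := Computable.ite'
    (Computable.nat_decide_lt Computable.fst (Computable.const _))
    (Computable.list_getD' _ (Computable.const _) Computable.fst)
    (Primrec.int_bit.to_comp.comp hAc (Computable.nat_sub' hN1 (Computable.succ.comp
      (Computable.nat_div' Computable.fst (Computable.const n)))))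
  have hLm : Monotone L := fun p q h => Nat.mul_le_mul_left _ (by simp only [hN]; omega)
  refine hW _ (hD.pushforwardMartingale hLm g)
    (hDc.pushforwardMartingale hLc hgc).uniformlyComputable fun C => ?_
  set c := n + 2 with hc
  obtain ⟨k₀, hk₀⟩ := Filter.eventually_atTop.1
    (hDZ.eventually_gt_atTop (C * 2 ^ (n * (c + κ))))
  -- `o` is dictated by `W`, which is why `D` must tend to infinity along `Z` and not merely be
  -- unbounded. The summand `c` gives `o ≥ c`, needed for `k ≤ N (n * o)`.
  obtain ⟨o, ho, hoW⟩ := hW.exists_not_constant n (k₀ + c)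
  set k := o + c + κ with hk
  have hok : o ≤ n * o := Nat.le_mul_of_pos_left o hn
  have hkk : k ≤ n * k := Nat.le_mul_of_pos_left k hn
  refine ⟨n * o, lt_of_lt_of_le ?_ (le_pushforwardMartingale (ρ := initialSegment Z (n * k)) hD
    ?_ ?_)⟩
  · rw [length_initialSegment, length_initialSegment, hk, add_assoc, mul_add n o, pow_add,
      ← div_div, div_self (by positivity), mul_one_div, lt_div_iff₀ (by positivity), ← mul_add,
      ← add_assoc]
    exact hk₀ (n * k) (by omega)
  · rw [length_initialSegment, length_initialSegment]
    exact Nat.mul_le_mul_left _ (by simp only [hN]; omega)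
  · rw [length_initialSegment]
    intro σ hσ p hp
    rw [getD_initialSegment W hp]
    by_cases hpj : p < n * j₀
    · simp only [hg, if_pos hpj]
      exact getD_initialSegment W hpj
    · simp only [hg, if_neg hpj]
      set ρ := (initialSegment Z (n * k) ++ σ).take (L p) with hρ
      set j := p / n with hj
      have hjp : j ≤ p := Nat.div_le_self p n
      have hj₀j : j₀ ≤ j := (Nat.le_div_iff_mul_le hn).2 (by rw [mul_comm]; omega)
      have hjo : j < o := Nat.div_lt_of_lt_mul hp
      have hbits : ∀ q < min k (N p), ∀ i : Fin n, ρ.getD (n * q + i) false = Z (n * q + i) := by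
        intro q hq i
        have hlt : ∀ m, q < m → n * q + i < n * m := fun m hm =>
          calc n * q + i < n * q + n := by omega
            _ = n * (q + 1) := by ring
            _ ≤ n * m := Nat.mul_le_mul_left _ hm
        have h1 := hlt k (hq.trans_le (min_le_left _ _))
        have h2 : n * q + i < L p := hlt (N p) (hq.trans_le (min_le_right _ _))
        rw [hρ, List.getD_eq_getElem?_getD, List.getElem?_take_of_lt h2,
          ← List.getD_eq_getElem?_getD, List.getD_append _ _ _ _ (by rwa [length_initialSegment]),
          getD_initialSegment Z h1]
      have herr : |(A p ρ : ℝ) / 2 ^ N p - f z (Fin.ofNat n p)| ≤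
          2 ^ κ * (2 ^ min k (N p))⁻¹ :=
        abs_approx_sub_le hK hκ.le (min_le_right _ _) hbits
          (ha ((dyadicNumerators z ρ (N p), N p), Fin.ofNat n p) (N p))
      have hfl : A p ρ / 2 ^ (N p - (j + 1)) = ⌊(A p ρ : ℝ) / 2 ^ N p * 2 ^ (j + 1)⌋ := by
        rw [floor_mul_two_pow _ (j + 1) (N p - (j + 1)),
          Nat.add_sub_cancel' (by simp only [hN]; omega), div_mul_cancel₀ _ (by positivity),
          Int.floor_intCast]
      have hp' : p = n * j + (Fin.ofNat n p : Fin n) := (Nat.div_add_mod p n).symm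
      have hsub : ∀ m, (2 : ℝ) ^ κ * (2 ^ (m + κ))⁻¹ = (2 ^ m)⁻¹ := fun m => by
        rw [pow_add]; field_simp
      rw [hfl]
      conv_rhs => rw [hp']
      -- If the input prefix read contains all `k` known digits, the error is at most `2 ^ (-(o +
      -- c))` and the block at `o` fixes the digit. Otherwise only digits of `z` were read and the
      -- error is at most `2 ^ (-(3 p + 1))`, so the block after digit `j` fixes it.
      rcases le_total k (N p) with hkN | hkN
      · rw [min_eq_left hkN, hk, hsub] at herr
        exact decide_floor_eq hoW hjo herr
      · rw [min_eq_right hkN, hN, hsub] at herr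
        refine decide_floor_eq (hj₀ j hj₀j) (Nat.lt_succ_self j) (herr.trans ?_)
        exact inv_anti₀ (by positivity) (pow_le_pow_right₀ (by norm_num) (by omega))
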